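/- Let $\overline\rho>0$, $f\in C^1[0,\overline\rho]$ with $f(0)=0$, $h:=f'$, and $g\in C[0,\overline\rho]$. Consider the equation $$\rho_t+f(\rho)_x=\bigl(D(\rho)\rho_x\bigr)_x+g(\rho),\qquad \rho\in[0,\overline\rho].$$ **Hypotheses.** - (g) $g>0$ on $[0,\overline\rho)$ and $g(\overline\rho)=0$. - (D) $D\in C^1[0,\overline\rho]$, $D(\overline\rho)=0$ and $D>0$ on $(0,\overline\rho)$. - ($\tilde{\mathrm D}$) $D\in C[0,\overline\rho]\cap C^1[0,\overline\rho)$, $D(\overline\rho)=0$, $D>0$ on $(0,\overline\rho)$, $\dot D(\overline\rho)=-\infty$ (as a limit of difference quotients), and $\lim_{s\to\overline\rho^-}\frac{D(s)g(s)}{s-\overline\rho}$ exists in $(-\infty,0]$. **Definitions.** Let $I\subseteq\mathbb R$ be an open interval and $c\in\mathbb R$. A continuous, a.e. differentiable $\varphi:I\to[0,\overline\rho]$ is a *traveling-wave profile* with speed $c$ on $I$ if $D(\varphi)\varphi'\in L^1_{\rm loc}(I)$, this function is the weak derivative of $\int_0^{\varphi}D(s)\,ds$, and $$\int_I\bigl\{(D(\varphi)\varphi'-f(\varphi)+c\varphi)\psi'-g(\varphi)\psi\bigr\}\,d\xi=0\qquad\text{for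 all }\psi\in C_0^\infty(I).$$ It is - *strict* if $I\ne\mathbb R$ and $\varphi$ does not extend to a traveling-wave profile with speed $c$ on $\mathbb R$; - *classical* on an open set $J\subseteq I$ (on $J=I$ if no set is mentioned) if it is differentiable at every point of $J$, $D(\varphi)\varphi'$ is absolutely continuous on compact intervals contained in $J$, and $(D(\varphi)\varphi')'+(c-h(\varphi))\varphi'+g(\varphi)=0$ a.e. in $J$; - *sharp at $\ell$* if $g(\ell)=0$ and there is $\xi_0\in I$ with $\varphi(\xi_0)=\ell$ such that $\varphi$ is classical on $I\setminus\{\xi_0\}$ and not differentiable at $\xi_0$; *sharp* means sharp at some $\ell$. A *semi-wavefront profile from* (respectively *to*) $\overline\rho$ is a (weakly) monotone, non-constant traveling-wave profile defined on some $(-\infty,\varpi)$ (respectively $(\varpi,\infty)$), $\varpi\in\mathbb R$, with limit $\overline\rho$ at $-\infty$ (respectively $+\infty$). **Theorem.** Assume (g), and (D) or ($\tilde{\mathrm D}$). For every $c\in\mathbb R$: 1. There are classical or sharp semi-wavefront profiles with speed $c$ both from $\overline\rho$ and to $\overline\rho$. They are unique up to shifts: in each of the two cases there is one such profile $\varphi$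 for which every classical or sharp semi-wavefront profile with speed $c$ of the same kind is the restriction to its own half-line of a shift of $\varphi$. All of these profiles are strict. 2. Assume (D). Every classical or sharp semi-wavefront profile from $\overline\rho$ with speed $c$ is sharp at $\overline\rho$ if $c<h(\overline\rho)$, and classical if $c>h(\overline\rho)$. Every classical or sharp semi-wavefront profile to $\overline\rho$ with speed $c$ is classical if $c<h(\overline\rho)$, and sharp at $\overline\rho$ if $c>h(\overline\rho)$. If $c=h(\overline\rho)$ and $\dot D(\overline\rho)<0$, all of them are classical. 3. Under ($\tilde{\mathrm D}$) all classical or sharp semi-wavefront profiles from and to $\overline\rho$ are classical. Finally, if (D) holds, $c=h(\overline\rho)$ and $\dot D(\overline\rho)=0$, both types can occur: for every $\overline\rho>0$ there are $f,D,g$ satisfying the above assumptions, (D), (g) and $\dot D(\overline\rho)=0$ for which, with $c=h(\overline\rho)$, there are classical semi-wavefront profiles from and to $\overline\rho$, and there are other such $f,D,g$ for which there are semi-wavefront profiles from and to $\overline\rho$ that are sharp at $\overline\rho$. -/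

import Mathlib

open Set Filter MeasureTheory
open scoped Topology ContDiff

noncomputable section

namespace SemiWavefront

/-! The equation is `ρ_t + f(ρ)_x = (D(ρ) ρ_x)_x + g(ρ)` for densities `ρ ∈ [0, R]`.
The coefficients are functions on `ℝ` of which only the values on `[0, R]` matter. -/

/-- Standing assumptions on the convective term and on the source term. -/
structure Standing (R : ℝ) (f g : ℝ → ℝ) : Prop where
  f_contDiff : ContDiffOn ℝ 1 f (Icc 0 R)
  f_zero : f 0 = 0
  g_continuous : ContinuousOn g (Icc 0 R)

/-- The derivative `h = f'` on `[0, R]` (one-sided at the end points). -/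
def advSpeed (R : ℝ) (f : ℝ → ℝ) (s : ℝ) : ℝ := derivWithin f (Icc 0 R) s

/-- Condition (g). -/
structure CondG (R : ℝ) (g : ℝ → ℝ) : Prop where
  pos : ∀ s ∈ Ico 0 R, 0 < g s
  zero : g R = 0

/-- Condition (D), including `D ∈ C¹[0, R]`. -/
structure CondD (R : ℝ) (D : ℝ → ℝ) : Prop where
  contDiff : ContDiffOn ℝ 1 D (Icc 0 R)
  zero : D R = 0
  pos : ∀ s ∈ Ioo 0 R, 0 < D s

/-- Condition (D̃), including `D ∈ C[0, R] ∩ C¹[0, R)`; the derivative of `D` at `R` is `-∞`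
and `D g / (· - R)` has a finite nonpositive left limit at `R`. -/
structure CondDTilde (R : ℝ) (D g : ℝ → ℝ) : Prop where
  continuous : ContinuousOn D (Icc 0 R)
  contDiff : ContDiffOn ℝ 1 D (Ico 0 R)
  zero : D R = 0
  pos : ∀ s ∈ Ioo 0 R, 0 < D s
  deriv_end : Tendsto (fun s => (D s - D R) / (s - R)) (𝓝[<] R) atBot
  limit : ∃ l : ℝ, l ≤ 0 ∧ Tendsto (fun s => D s * g s / (s - R)) (𝓝[<] R) (𝓝 l)

/-- The diffusive term `D(φ) φ'`. -/
def flux (D φ : ℝ → ℝ) (ξ : ℝ) : ℝ := D (φ ξ) * deriv φ ξ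

/-- `φ` is, on the open interval `I`, the profile of a traveling-wave solution with speed `c`.
The locally integrable function `D(φ) φ'` is the derivative of `∫₀^φ D` in the weak sense
(field `flux_weak`), so that no singular part (as for Cantor's function) is lost; for classical
and for sharp profiles this field is a consequence of the other requirements. -/
structure IsTravelingWave (R : ℝ) (f D g : ℝ → ℝ) (c : ℝ) (I : Set ℝ) (φ : ℝ → ℝ) : Prop where
  isOpen : IsOpen I
  ordConnected : I.OrdConnected
  mapsTo : MapsTo φ I (Icc 0 R)
  continuous : ContinuousOn φ I
  ae_differentiable : ∀ᵐ ξ ∂volume.restrict I, DifferentiableAt ℝ φ ξ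
  flux_locallyIntegrable : LocallyIntegrableOn (flux D φ) I
  flux_weak : ∀ a ∈ I, ∀ b ∈ I,
    (∫ s in (φ a)..(φ b), D s) = ∫ ξ in a..b, flux D φ ξ
  weak_eq : ∀ ψ : ℝ → ℝ, ContDiff ℝ ∞ ψ → HasCompactSupport ψ → tsupport ψ ⊆ I →
    ∫ ξ in I, ((flux D φ ξ - f (φ ξ) + c * φ ξ) * deriv ψ ξ - g (φ ξ) * ψ ξ) = 0

/-- `φ` is classical on the open set `J`: it is differentiable, `D(φ) φ'` is absolutely
continuous on the compact intervals contained in `J`, and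
`(D(φ) φ')' + (c - h(φ)) φ' + g(φ) = 0` a.e. in `J`. -/
structure IsClassicalOn (R : ℝ) (f D g : ℝ → ℝ) (c : ℝ) (J : Set ℝ) (φ : ℝ → ℝ) : Prop where
  differentiable : ∀ ξ ∈ J, DifferentiableAt ℝ φ ξ
  flux_ac : ∀ a b : ℝ, uIcc a b ⊆ J → AbsolutelyContinuousOnInterval (flux D φ) a b
  ae_eq : ∀ᵐ ξ ∂volume.restrict J,
    deriv (flux D φ) ξ + (c - advSpeed R f (φ ξ)) * deriv φ ξ + g (φ ξ) = 0

/-- `φ` is sharp at `l` on the open interval `I`. -/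
def IsSharpAt (R : ℝ) (f D g : ℝ → ℝ) (c : ℝ) (I : Set ℝ) (φ : ℝ → ℝ) (l : ℝ) : Prop :=
  g l = 0 ∧ ∃ ξ₀ ∈ I, φ ξ₀ = l ∧ IsClassicalOn R f D g c (I \ {ξ₀}) φ ∧
    ¬ DifferentiableAt ℝ φ ξ₀

/-- `φ` is classical or sharp (at some value). -/
def IsClassicalOrSharp (R : ℝ) (f D g : ℝ → ℝ) (c : ℝ) (I : Set ℝ) (φ : ℝ → ℝ) : Prop :=
  IsClassicalOn R f D g c I φ ∨ ∃ l, IsSharpAt R f D g c I φ l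

/-- `φ`, defined in `I`, is strict: `I ≠ ℝ` and `φ` does not extend to (the profile of) a
traveling-wave solution on the whole of `ℝ`. -/
def IsStrict (R : ℝ) (f D g : ℝ → ℝ) (c : ℝ) (I : Set ℝ) (φ : ℝ → ℝ) : Prop :=
  I ≠ univ ∧ ¬ ∃ φ' : ℝ → ℝ, IsTravelingWave R f D g c univ φ' ∧ EqOn φ' φ I

/-- Weakly monotone and not identically constant on `I`. -/
def IsMonotonicNonconst (I : Set ℝ) (φ : ℝ → ℝ) : Prop :=
  (MonotoneOn φ I ∨ AntitoneOn φ I) ∧ ∃ ξ₁ ∈ I, ∃ ξ₂ ∈ I, φ ξ₁ ≠ φ ξ₂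

/-- `φ` is, on `(-∞, w)`, the profile of a semi-wavefront solution from `l`. -/
structure IsSemiWavefrontFrom (R : ℝ) (f D g : ℝ → ℝ) (c l w : ℝ) (φ : ℝ → ℝ) : Prop where
  wave : IsTravelingWave R f D g c (Iio w) φ
  mem : l ∈ Icc 0 R
  zero : g l = 0
  monotonic : IsMonotonicNonconst (Iio w) φ
  tendsto : Tendsto φ atBot (𝓝 l)

/-- `φ` is, on `(w, ∞)`, the profile of a semi-wavefront solution to `l`. -/
structure IsSemiWavefrontTo (R : ℝ) (f D g : ℝ → ℝ) (c l w : ℝ) (φ : ℝ → ℝ) : Prop where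
  wave : IsTravelingWave R f D g c (Ioi w) φ
  mem : l ∈ Icc 0 R
  zero : g l = 0
  monotonic : IsMonotonicNonconst (Ioi w) φ
  tendsto : Tendsto φ atTop (𝓝 l)

/-- Classical or sharp semi-wavefront profile from `R` on `(-∞, w)`. -/
def ProfileFrom (R : ℝ) (f D g : ℝ → ℝ) (c w : ℝ) (φ : ℝ → ℝ) : Prop :=
  IsSemiWavefrontFrom R f D g c R w φ ∧ IsClassicalOrSharp R f D g c (Iio w) φ

/-- Classical or sharp semi-wavefront profile to `R` on `(w, ∞)`. -/
def ProfileTo (R : ℝ) (f D g : ℝ → ℝ) (c w : ℝ) (φ : ℝ → ℝ) : Prop :=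
  IsSemiWavefrontTo R f D g c R w φ ∧ IsClassicalOrSharp R f D g c (Ioi w) φ

end SemiWavefront

end

open Set Filter MeasureTheory
open scoped Topology ContDiff

noncomputable section

namespace SemiWavefront

/-! A decreasing profile is governed by its diffusive term as a function of the density. Writing
`D(φ) φ' = -y(φ)` turns the second-order equation into the singular problem `y' = c - h - D g / y`
on `(0, R)` with `y > 0` and `y R = 0` (`IsPhase`). Truncating the denominator to `max y δ` makes it
regular; the truncated solutions increase as `δ` decreases, and barriers independent of `δ` carry
the equation to the limit (`exists_singular_solution`). The profile is the inverse of `s ↦ ∫ D / y`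
over `[s, R/2]`. Since `g` is bounded below away from `R`, density `0` is reached in finite time.

For a weak solution let `Z` be the continuous version of `D(φ) φ'`. Then `Z + y(φ)` solves a linear
damped equation, so its square cannot grow with `ξ`. For a semi-wavefront from `R` it must vanish,
by its value at the last earlier point where `φ = R` or by its behaviour at `-∞` (`Z_eq_neg_phase`).
Hence `φ` solves a separable equation and is unique up to shifts. Strictness holds because a wave on
the whole line with `Z < 0` at a density below `R` would be pushed by the source until the primitive
of `D` along it becomes negative (`not_Z_neg`).

Differentiability can fail only at the last point where `φ = R`, with slope `-y / D` to its right.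
Thus `y = o(D)` at `R` gives a classical profile and `y ≥ δ D` a sharp one; comparing `y` with
multiples of `D` and of `R - s` decides which. Profiles to `R` follow by the reflection `ξ ↦ -ξ`, `f
↦ -f`, `c ↦ -c`. -/

/-- Backward comparison: a function that does not decrease where it is positive, and is
nonpositive at the right end point, is nonpositive. -/
theorem nonpos_of_deriv_nonneg_of_pos {G G' : ℝ → ℝ} {a b : ℝ} (hcont : ContinuousOn G (Icc a b))
    (hderiv : ∀ s ∈ Ioo a b, HasDerivAt G (G' s) s) (hend : G b ≤ 0)
    (hmono : ∀ s ∈ Ioo a b, 0 < G s → 0 ≤ G' s) : ∀ s ∈ Icc a b, G s ≤ 0 := by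
  intro s hs
  by_contra! hpos
  -- Up to the first point `t` of `A` the function is positive, hence nondecreasing, so `G s ≤ G t ≤
  -- 0`.
  set A := Icc s b ∩ G ⁻¹' Iic 0 with hA
  have hcs : ContinuousOn G (Icc s b) := hcont.mono (Icc_subset_Icc_left hs.1)
  have hAcl : IsClosed A := hcs.preimage_isClosed_of_isClosed isClosed_Icc isClosed_Iic
  have hAne : A.Nonempty := ⟨b, ⟨hs.2, le_rfl⟩, hend⟩
  have hAbd : BddBelow A := ⟨s, fun x hx => hx.1.1⟩
  have ht : sInf A ∈ A := hAcl.csInf_mem hAne hAbd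
  set t := sInf A
  have hlt : ∀ x ∈ Ico s t, 0 < G x := by
    intro x hx
    by_contra! hx0
    exact absurd (csInf_le hAbd (⟨⟨hx.1, hx.2.le.trans ht.1.2⟩, hx0⟩ : x ∈ A)) (not_le.2 hx.2)
  have hm : MonotoneOn G (Icc s t) := by
    refine monotoneOn_of_hasDerivWithinAt_nonneg (f' := G') (convex_Icc s t)
      (hcs.mono (Icc_subset_Icc_right ht.1.2)) ?_ ?_
    · intro x hx
      rw [interior_Icc] at hx
      exact (hderiv x ⟨hs.1.trans_lt hx.1, hx.2.trans_le ht.1.2⟩).hasDerivWithinAt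
    · intro x hx
      rw [interior_Icc] at hx
      exact hmono x ⟨hs.1.trans_lt hx.1, hx.2.trans_le ht.1.2⟩ (hlt x ⟨hx.1.le, hx.2⟩)
  have := hm (left_mem_Icc.2 ht.1.1) (right_mem_Icc.2 ht.1.1) ht.1.1
  have h2 : G t ≤ 0 := ht.2
  linarith

/-! ### The singular terminal value problem, by truncation -/

/-- Solution on `[0, R]` of the terminal value problem `y' = κ - p / max y δ`, `y R = 0`. -/
structure IsTruncatedSolution (R : ℝ) (κ p : ℝ → ℝ) (δ : ℝ) (y : ℝ → ℝ) : Prop where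
  continuous : ContinuousOn y (Icc 0 R)
  terminal : y R = 0
  hasDerivAt : ∀ s ∈ Ioo 0 R, HasDerivAt y (κ s - p s / max (y s) δ) s

section Truncated

variable {R : ℝ} {κ p : ℝ → ℝ} {δ C P : ℝ}

/-- The truncated right-hand side is bounded by `C + P / δ` and is `P / δ ^ 2`-Lipschitz in `x`. In
the ball of radius `(C + P / δ) * R` one application of Picard–Lindelöf therefore covers all of `[0,
R]`. -/
theorem exists_isTruncatedSolution (hR : 0 < R) (hκ : ContinuousOn κ (Icc 0 R))
    (hp : ContinuousOn p (Icc 0 R)) (hκC : ∀ s ∈ Icc 0 R, |κ s| ≤ C)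
    (hp0 : ∀ s ∈ Icc 0 R, 0 ≤ p s) (hpP : ∀ s ∈ Icc 0 R, p s ≤ P) (hδ : 0 < δ) :
    ∃ y, IsTruncatedSolution R κ p δ y := by
  have hRm : R ∈ Icc (0 : ℝ) R := right_mem_Icc.2 hR.le
  have hC : 0 ≤ C := (abs_nonneg _).trans (hκC R hRm)
  have hP : 0 ≤ P := (hp0 R hRm).trans (hpP R hRm)
  have hmax : ∀ x, 0 < max x δ := fun x => hδ.trans_le (le_max_right _ _)
  have hL : 0 ≤ C + P / δ := by positivity
  have key : IsPicardLindelof (fun s x => κ s - p s / max x δ) (tmin := 0) (tmax := R) ⟨R, hRm⟩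
      (0 : ℝ) ⟨(C + P / δ) * R, by positivity⟩ 0 ⟨C + P / δ, hL⟩ ⟨P / δ ^ 2, by positivity⟩ := by
    refine ⟨fun t ht => ?_, fun x _ => ?_, fun t ht x _ => ?_, ?_⟩
    · refine LipschitzWith.lipschitzOnWith (LipschitzWith.of_dist_le_mul fun u v => ?_)
      rw [Real.dist_eq, Real.dist_eq]
      change |_| ≤ P / δ ^ 2 * |u - v|
      have e : κ t - p t / max u δ - (κ t - p t / max v δ)
          = p t * (max u δ - max v δ) / (max u δ * max v δ) := by
        have := (hmax u).ne'
        have := (hmax v).ne'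
        field_simp
        ring
      rw [e, abs_div, abs_mul, abs_of_nonneg (hp0 t ht),
        abs_of_pos (mul_pos (hmax u) (hmax v)), div_mul_eq_mul_div]
      refine div_le_div₀ (by positivity) ?_ (by positivity) ?_
      · exact mul_le_mul (hpP t ht) (abs_max_sub_max_le_abs u v δ) (abs_nonneg _) hP
      · rw [sq]
        exact mul_le_mul (le_max_right _ _) (le_max_right _ _) hδ.le (hmax u).le
    · exact hκ.sub (hp.div_const _)
    · change |_| ≤ C + P / δ
      refine (abs_sub _ _).trans (add_le_add (hκC t ht) ?_)
      rw [abs_of_nonneg (div_nonneg (hp0 t ht) (hmax x).le)]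
      exact div_le_div₀ hP (hpP t ht) hδ (le_max_right _ _)
    · change (C + P / δ) * max (R - R) (R - 0) ≤ (C + P / δ) * R - 0
      simp [hR.le]
  obtain ⟨y, hy0, hy⟩ := key.exists_eq_forall_mem_Icc_hasDerivWithinAt₀
  exact ⟨y, fun s hs => (hy s hs).continuousWithinAt, hy0, fun s hs =>
    (hy s (Ioo_subset_Icc_self hs)).hasDerivAt (Icc_mem_nhds hs.1 hs.2)⟩

variable {y : ℝ → ℝ}

/-- Where `y' > y` the denominator for `y'` is the larger one, so `y' - y` cannot decrease there; as
it vanishes at `R`, it is never positive. -/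
theorem IsTruncatedSolution.le_of_le {δ' : ℝ} {y' : ℝ → ℝ} (h : IsTruncatedSolution R κ p δ y)
    (h' : IsTruncatedSolution R κ p δ' y') (hp0 : ∀ s ∈ Icc 0 R, 0 ≤ p s) (hδ : 0 < δ)
    (hle : δ ≤ δ') : ∀ s ∈ Icc 0 R, y' s ≤ y s := by
  intro s hs
  refine sub_nonpos.1 (nonpos_of_deriv_nonneg_of_pos (G := fun t => y' t - y t)
    (h'.continuous.sub h.continuous)
    (fun t ht => (h'.hasDerivAt t ht).sub (h.hasDerivAt t ht)) ?_ ?_ s hs)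
  · simp [h.terminal, h'.terminal]
  · intro t ht hpos
    have h1 : max (y t) δ ≤ max (y' t) δ' := max_le_max (by linarith) hle
    have h2 : p t / max (y' t) δ' ≤ p t / max (y t) δ :=
      div_le_div_of_nonneg_left (hp0 t (Ioo_subset_Icc_self ht))
        (hδ.trans_le (le_max_right _ _)) h1
    linarith

theorem IsTruncatedSolution.lower (h : IsTruncatedSolution R κ p δ y)
    (hκC : ∀ s ∈ Icc 0 R, |κ s| ≤ C) (hp0 : ∀ s ∈ Icc 0 R, 0 ≤ p s) (hδ : 0 < δ) :
    ∀ s ∈ Icc 0 R, -(C * (R - s)) ≤ y s := by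
  intro s hs
  have := nonpos_of_deriv_nonneg_of_pos (G := fun t => -(C * (R - t)) - y t)
    (G' := fun t => -(C * -1) - (κ t - p t / max (y t) δ))
    ((by fun_prop : Continuous fun t => -(C * (R - t))).continuousOn.sub h.continuous)
    (fun t ht => ((((hasDerivAt_id t).const_sub R).const_mul C).neg).sub (h.hasDerivAt t ht))
    (by simp [h.terminal]) (fun t ht _ => by
      have ht' := Ioo_subset_Icc_self ht
      have h1 := (abs_le.1 (hκC t ht')).2
      have h2 : 0 ≤ p t / max (y t) δ :=
        div_nonneg (hp0 t ht') (hδ.le.trans (le_max_right _ _))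
      linarith) s hs
  linarith

/-- Above height `ε` the singular term is at most `P / ε`, whatever `δ` is. The freedom in `ε` is
what forces the limit `δ → 0` to tend to `0` at `R`. -/
theorem IsTruncatedSolution.upper (h : IsTruncatedSolution R κ p δ y)
    (hκC : ∀ s ∈ Icc 0 R, |κ s| ≤ C)
    (hpP : ∀ s ∈ Icc 0 R, p s ≤ P) (hP : 0 ≤ P) (hC : 0 ≤ C) {ε : ℝ} (hε : 0 < ε) :
    ∀ s ∈ Icc 0 R, y s ≤ ε + (C + P / ε) * (R - s) := by
  intro s hs
  have := nonpos_of_deriv_nonneg_of_pos (G := fun t => y t - (ε + (C + P / ε) * (R - t)))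
    (G' := fun t => (κ t - p t / max (y t) δ) - (C + P / ε) * -1)
    (h.continuous.sub (by fun_prop : Continuous fun t => ε + (C + P / ε) * (R - t)).continuousOn)
    (fun t ht => (h.hasDerivAt t ht).sub
      ((((hasDerivAt_id t).const_sub R).const_mul (C + P / ε)).const_add ε))
    (by simp [h.terminal, hε.le]) (fun t ht hpos => by
      have ht' := Ioo_subset_Icc_self ht
      have h1 := (abs_le.1 (hκC t ht')).1
      have h3 : 0 ≤ (C + P / ε) * (R - t) :=
        mul_nonneg (by positivity) (sub_nonneg.2 ht.2.le)
      have h4 : ε ≤ max (y t) δ := le_max_of_le_left (by linarith)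
      have h2 : p t / max (y t) δ ≤ P / ε := div_le_div₀ hP (hpP t ht') hε h4
      linarith) s hs
  linarith

/-- A solution lying too low is pulled down so fast by `p / max y δ` that it would fall through the
floor `-C (R - s)` before reaching `R`. The bound `m` does not depend on `δ`. -/
theorem exists_pos_le_isTruncatedSolution (hp : ContinuousOn p (Icc 0 R))
    (hκC : ∀ s ∈ Icc 0 R, |κ s| ≤ C) (hC : 0 ≤ C)
    (hp0 : ∀ s ∈ Icc 0 R, 0 ≤ p s) (hppos : ∀ s ∈ Ioo 0 R, 0 < p s) {a b : ℝ} (ha : 0 < a)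
    (hab : a ≤ b) (hb : b < R) :
    ∃ m > 0, ∀ δ, 0 < δ → δ ≤ m → ∀ y, IsTruncatedSolution R κ p δ y →
      ∀ s ∈ Icc a b, m ≤ y s := by
  set b' := (b + R) / 2 with hb'
  have hbb' : b < b' := by rw [hb']; linarith
  have hb'R : b' < R := by rw [hb']; linarith
  obtain ⟨x0, hx0, hmin⟩ := isCompact_Icc.exists_isMinOn (nonempty_Icc.2 (hab.trans hbb'.le))
    (hp.mono (Icc_subset_Icc ha.le hb'R.le))
  have hR : 0 < R := by linarith
  have hp1 : 0 < p x0 := hppos x0 ⟨ha.trans_le hx0.1, hx0.2.trans_lt hb'R⟩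
  -- Descending at rate `K` over a length of at least `b' - b`, from a height of at most `1`, ends
  -- at or below `-C * R`.
  set K := (C * R + 1) / (b' - b) with hK
  have hd : 0 < b' - b := sub_pos.2 hbb'
  have hKpos : 0 < K := by positivity
  refine ⟨min 1 (p x0 / (C + K)), by positivity, fun δ hδ hδm y hy s hs => ?_⟩
  set m := min 1 (p x0 / (C + K)) with hm
  have hmpos : 0 < m := by positivity
  have hsb' : s < b' := hs.2.trans_lt hbb'
  have hsub : Icc s b' ⊆ Icc 0 R := Icc_subset_Icc (ha.le.trans hs.1) hb'R.le
  have hm1 : C + K ≤ p x0 / m := by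
    rw [le_div_iff₀ hmpos]
    have := (min_le_right 1 (p x0 / (C + K)))
    rw [← hm, le_div_iff₀ (by positivity)] at this
    linarith
  have := nonpos_of_deriv_nonneg_of_pos (G := fun t => (m + K * (s - t)) - y t)
    (G' := fun t => K * -1 - (κ t - p t / max (y t) δ)) (a := s) (b := b')
    ((by fun_prop : Continuous fun t => m + K * (s - t)).continuousOn.sub
      (hy.continuous.mono hsub))
    (fun t ht => ((((hasDerivAt_id t).const_sub s).const_mul K).const_add m).sub
      (hy.hasDerivAt t ⟨(ha.trans_le hs.1).trans ht.1, ht.2.trans hb'R⟩)) ?_ ?_ s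
      (left_mem_Icc.2 hsb'.le)
  · simp only [sub_self, mul_zero, add_zero, sub_nonpos] at this
    exact this
  · have h1 := hy.lower hκC hp0 hδ b' (hsub (right_mem_Icc.2 hsb'.le))
    have h2 : K * (b' - b) = C * R + 1 := by rw [hK]; field_simp
    have h3 : K * (b' - b) ≤ K * (b' - s) :=
      mul_le_mul_of_nonneg_left (by linarith [hs.2]) hKpos.le
    have h4 : m ≤ 1 := min_le_left _ _
    have h5 : C * (R - b') ≤ C * R :=
      mul_le_mul_of_nonneg_left (by linarith [hs.1]) hC
    change m + K * (s - b') - y b' ≤ 0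
    linarith
  · intro t ht hpos
    have ht' : t ∈ Icc (0 : ℝ) R := hsub (Ioo_subset_Icc_self ht)
    have h0 : 0 ≤ K * (t - s) := mul_nonneg hKpos.le (by linarith [ht.1])
    have h1 : max (y t) δ ≤ m := max_le (by linarith) hδm
    have h2 : p x0 ≤ p t := hmin ⟨hs.1.trans ht.1.le, ht.2.le⟩
    have h3 : p x0 / m ≤ p t / max (y t) δ :=
      div_le_div₀ (hp0 t ht') h2 (hδ.trans_le (le_max_right _ _)) h1
    have h4 := (abs_le.1 (hκC t ht')).2
    linarith

end Truncated

/-- Existence for the singular terminal value problem `y' = κ - p / y`, `y R = 0`. -/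
theorem exists_singular_solution {R : ℝ} {κ p : ℝ → ℝ} (hR : 0 < R)
    (hκ : ContinuousOn κ (Icc 0 R)) (hp : ContinuousOn p (Icc 0 R))
    (hp0 : ∀ s ∈ Icc 0 R, 0 ≤ p s) (hppos : ∀ s ∈ Ioo 0 R, 0 < p s) :
    ∃ y : ℝ → ℝ, ContinuousOn y (Ioc 0 R) ∧ y R = 0 ∧ (∀ s ∈ Ioo 0 R, 0 < y s) ∧
      (∀ s ∈ Ioo 0 R, HasDerivAt y (κ s - p s / y s) s) ∧ ∃ M, ∀ s ∈ Ioc 0 R, y s ≤ M := by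
  obtain ⟨C, hκC⟩ := isCompact_Icc.exists_bound_of_continuousOn hκ
  obtain ⟨P, hpP'⟩ := isCompact_Icc.exists_bound_of_continuousOn hp
  have hRm : R ∈ Icc (0 : ℝ) R := right_mem_Icc.2 hR.le
  have hpP : ∀ s ∈ Icc 0 R, p s ≤ P := fun s hs => (le_abs_self _).trans (hpP' s hs)
  have hC : 0 ≤ C := (norm_nonneg _).trans (hκC R hRm)
  have hP : 0 ≤ P := (norm_nonneg _).trans (hpP' R hRm)
  have hδ : ∀ n : ℕ, (0 : ℝ) < 1 / ((n : ℝ) + 1) := fun n => by positivity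
  choose Y hY using fun n : ℕ => exists_isTruncatedSolution hR hκ hp hκC hp0 hpP (hδ n)
  have hmono : ∀ s ∈ Icc 0 R, Monotone fun n => Y n s := fun s hs =>
    fun m n hmn => (hY n).le_of_le (hY m) hp0 (hδ n) (one_div_le_one_div_of_le (by positivity)
      (by exact_mod_cast Nat.succ_le_succ hmn)) s hs
  have hup : ∀ ε > 0, ∀ s ∈ Icc 0 R, ∀ n, Y n s ≤ ε + (C + P / ε) * (R - s) :=
    fun ε hε s hs n => (hY n).upper hκC hpP hP hC hε s hs
  have hlim : ∀ s ∈ Icc 0 R, Tendsto (fun n => Y n s) atTop (𝓝 (⨆ n, Y n s)) := fun s hs =>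
    tendsto_atTop_ciSup (hmono s hs) ⟨1 + (C + P / 1) * (R - s), by
      rintro _ ⟨n, rfl⟩; exact hup 1 one_pos s hs n⟩
  set y : ℝ → ℝ := fun s => ⨆ n, Y n s with hy
  have hyup : ∀ ε > 0, ∀ s ∈ Icc 0 R, y s ≤ ε + (C + P / ε) * (R - s) :=
    fun ε hε s hs => le_of_tendsto' (hlim s hs) (hup ε hε s hs)
  have hyR : y R = 0 := by simp [hy, (hY _).terminal]
  -- uniform positivity on compact subintervals
  have hlow : ∀ a b, 0 < a → a ≤ b → b < R → ∃ m > 0, ∃ N : ℕ, ∀ n ≥ N,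
      1 / ((n : ℝ) + 1) ≤ m ∧ ∀ s ∈ Icc a b, m ≤ Y n s := by
    intro a b ha hab hb
    obtain ⟨m, hm, h⟩ := exists_pos_le_isTruncatedSolution hp hκC hC hp0 hppos ha hab hb
    obtain ⟨N, hN⟩ := exists_nat_one_div_lt hm
    refine ⟨m, hm, N, fun n hn => ?_⟩
    have : 1 / ((n : ℝ) + 1) ≤ m :=
      (one_div_le_one_div_of_le (by positivity) (by exact_mod_cast Nat.succ_le_succ hn)).trans hN.le
    exact ⟨this, h _ (hδ n) this _ (hY n)⟩
  have hylow : ∀ a b, 0 < a → a ≤ b → b < R → ∃ m > 0, ∀ s ∈ Icc a b, m ≤ y s := by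
    intro a b ha hab hb
    obtain ⟨m, hm, N, h⟩ := hlow a b ha hab hb
    exact ⟨m, hm, fun s hs => ge_of_tendsto (hlim s ⟨ha.le.trans hs.1, hs.2.trans hb.le⟩)
      (eventually_atTop.2 ⟨N, fun n hn => (h n hn).2 s hs⟩)⟩
  have hypos : ∀ s ∈ Ioo 0 R, 0 < y s := by
    intro s hs
    obtain ⟨m, hm, h⟩ := hylow s s hs.1 le_rfl hs.2
    exact hm.trans_le (h s ⟨le_rfl, le_rfl⟩)
  -- the integrated equation
  have hint : ∀ a b, 0 < a → a ≤ b → b < R →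
      y b - y a = ∫ s in a..b, (κ s - p s / y s) := by
    intro a b ha hab hb
    obtain ⟨m, hm, N, h⟩ := hlow a b ha hab hb
    have hsub : Icc a b ⊆ Icc 0 R := Icc_subset_Icc ha.le hb.le
    have hcn : ∀ n ≥ N, ContinuousOn (fun s => κ s - p s / Y n s) (Icc a b) := fun n hn =>
      (hκ.mono hsub).sub ((hp.mono hsub).div ((hY n).continuous.mono hsub)
        fun s hs => (hm.trans_le ((h n hn).2 s hs)).ne')
    have heq : ∀ n ≥ N, Y n b - Y n a = ∫ s in a..b, (κ s - p s / Y n s) := by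
      intro n hn
      rw [intervalIntegral.integral_eq_sub_of_hasDerivAt_of_le hab
        ((hY n).continuous.mono hsub) (fun s hs => ?_)
        ((hcn n hn).intervalIntegrable_of_Icc hab)]
      have := (hY n).hasDerivAt s ⟨ha.trans hs.1, hs.2.trans hb⟩
      -- Since `1 / (n + 1) ≤ m ≤ Y n s`, the truncation is inactive on `[a, b]`.
      rwa [max_eq_left ((h n hn).1.trans ((h n hn).2 s (Ioo_subset_Icc_self hs)))] at this
    have hae : ∀ s, s ∈ uIoc a b → s ∈ Icc a b := fun s hs => by
      rw [uIoc_of_le hab] at hs; exact Ioc_subset_Icc_self hs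
    have hI : Tendsto (fun n => ∫ s in a..b, (κ s - p s / Y n s)) atTop
        (𝓝 (∫ s in a..b, (κ s - p s / y s))) := by
      refine intervalIntegral.tendsto_integral_filter_of_dominated_convergence
        (fun _ => C + P / m) ?_ ?_ intervalIntegrable_const ?_
      · filter_upwards [eventually_ge_atTop N] with n hn
        rw [uIoc_of_le hab]
        exact ((hcn n hn).mono Ioc_subset_Icc_self).aestronglyMeasurable measurableSet_Ioc
      · filter_upwards [eventually_ge_atTop N] with n hn
        refine Eventually.of_forall fun s hs => ?_
        have hs' := hae s hs
        have hpos := hm.trans_le ((h n hn).2 s hs')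
        refine (norm_sub_le _ _).trans (add_le_add (hκC s (hsub hs')) ?_)
        rw [Real.norm_of_nonneg (div_nonneg (hp0 s (hsub hs')) hpos.le)]
        exact div_le_div₀ hP (hpP s (hsub hs')) hm ((h n hn).2 s hs')
      · refine Eventually.of_forall fun s hs => ?_
        have hs' := hae s hs
        exact tendsto_const_nhds.sub (tendsto_const_nhds.div (hlim s (hsub hs'))
          (hypos s ⟨ha.trans_le hs'.1, hs'.2.trans_lt hb⟩).ne')
    refine tendsto_nhds_unique ((hlim b (hsub (right_mem_Icc.2 hab))).sub
      (hlim a (hsub (left_mem_Icc.2 hab)))) (hI.congr' ?_)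
    filter_upwards [eventually_ge_atTop N] with n hn using (heq n hn).symm
  -- continuity in the interior
  have hcont : ContinuousOn y (Ioo 0 R) := by
    intro s hs
    obtain ⟨a, ha, has⟩ := exists_between hs.1
    obtain ⟨b, hsb, hb⟩ := exists_between hs.2
    obtain ⟨m, hm, h⟩ := hylow a b ha (has.trans hsb).le hb
    have hLip : LipschitzOnWith ⟨C + P / m, by positivity⟩ y (Icc a b) := by
      refine LipschitzOnWith.of_dist_le_mul fun u hu v hv => ?_
      wlog huv : v ≤ u generalizing u v
      · rw [dist_comm (y u), dist_comm u]; exact this v hv u hu (le_of_not_ge huv)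
      rw [Real.dist_eq, Real.dist_eq, hint v u (ha.trans_le hv.1) huv (hu.2.trans_lt hb)]
      change ‖∫ s in v..u, (κ s - p s / y s)‖ ≤ (C + P / m) * |u - v|
      refine intervalIntegral.norm_integral_le_of_norm_le_const fun t ht => ?_
      rw [uIoc_of_le huv] at ht
      have htI : t ∈ Icc a b := ⟨hv.1.trans ht.1.le, ht.2.trans hu.2⟩
      have ht0 : t ∈ Icc 0 R := ⟨ha.le.trans htI.1, htI.2.trans hb.le⟩
      have hpos := hm.trans_le (h t htI)
      refine (norm_sub_le _ _).trans (add_le_add (hκC t ht0) ?_)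
      rw [Real.norm_of_nonneg (div_nonneg (hp0 t ht0) hpos.le)]
      exact div_le_div₀ hP (hpP t ht0) hm (h t htI)
    exact (hLip.continuousOn.continuousAt (Icc_mem_nhds has hsb)).continuousWithinAt
  have hcontF : ContinuousOn (fun s => κ s - p s / y s) (Ioo 0 R) :=
    (hκ.mono Ioo_subset_Icc_self).sub ((hp.mono Ioo_subset_Icc_self).div hcont
      fun s hs => (hypos s hs).ne')
  refine ⟨y, ?_, hyR, hypos, ?_, 1 + (C + P / 1) * R, ?_⟩
  · intro s hs
    rcases hs.2.eq_or_lt with rfl | hlt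
    · rw [ContinuousWithinAt, hyR, Metric.tendsto_nhdsWithin_nhds]
      intro ε hε
      have hA : 0 ≤ C + P / (ε / 2) := by positivity
      -- The barrier of level `ε / 2` bounds `y x`; this radius keeps its linear part below `ε / 2`.
      refine ⟨ε / 2 / (C + P / (ε / 2) + 1), by positivity, fun x hx hd => ?_⟩
      have h0 : 0 ≤ y x := by
        rcases hx.2.eq_or_lt with rfl | hlt
        · exact hyR.ge
        · exact (hypos x ⟨hx.1, hlt⟩).le
      rw [Real.dist_eq, sub_zero, abs_of_nonneg h0]
      rw [Real.dist_eq, abs_sub_comm, abs_of_nonneg (sub_nonneg.2 hx.2),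
        lt_div_iff₀ (by positivity)] at hd
      have := hyup (ε / 2) (by positivity) x ⟨hx.1.le, hx.2⟩
      nlinarith [hx.2]
    · exact (hcont.continuousAt (Ioo_mem_nhds hs.1 hlt)).continuousWithinAt
  · intro s hs
    obtain ⟨a, ha, has⟩ := exists_between hs.1
    have hev : y =ᶠ[𝓝 s] fun u => y a + ∫ t in a..u, (κ t - p t / y t) := by
      filter_upwards [Ioo_mem_nhds has hs.2] with u hu
      rw [← hint a u ha hu.1.le hu.2]; ring
    refine HasDerivAt.congr_of_eventuallyEq ?_ hev
    refine (intervalIntegral.integral_hasDerivAt_right ?_ ?_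
      (hcontF.continuousAt (Ioo_mem_nhds hs.1 hs.2))).const_add _
    · exact (hcontF.mono fun x hx => ⟨ha.trans_le hx.1, hx.2.trans_lt hs.2⟩).intervalIntegrable_of_Icc
        has.le
    · exact hcontF.stronglyMeasurableAtFilter isOpen_Ioo s hs
  · intro s hs
    refine (hyup 1 one_pos s ⟨hs.1.le, hs.2⟩).trans ?_
    have : 0 ≤ C + P / 1 := by positivity
    nlinarith [hs.1]

/-! ### Test functions -/

theorem integrable_mul_of_tsupport_subset {I : Set ℝ} {Q η : ℝ → ℝ}
    (hQ : LocallyIntegrableOn Q I) (hη : Continuous η) (hηc : HasCompactSupport η)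
    (hηI : tsupport η ⊆ I) : Integrable fun x => Q x * η x := by
  have h1 : IntegrableOn Q (tsupport η) := hQ.integrableOn_compact_subset hηI hηc
  refine (integrableOn_iff_integrable_of_support_subset (s := tsupport η) ?_).1
    (h1.mul_continuousOn hη.continuousOn hηc)
  exact (Function.support_mul_subset_right _ _).trans subset_closure

theorem setIntegral_eq_integral_of_tsupport_subset {I : Set ℝ} {u η : ℝ → ℝ}
    (hηI : tsupport η ⊆ I) (hu : ∀ x, x ∉ tsupport η → u x = 0) :
    ∫ x in I, u x = ∫ x, u x :=
  setIntegral_eq_integral_of_forall_compl_eq_zero fun x hx => hu x fun h => hx (hηI h)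

theorem deriv_eq_zero_of_notMem_tsupport {ψ : ℝ → ℝ} {x : ℝ} (hx : x ∉ tsupport ψ) :
    deriv ψ x = 0 :=
  image_eq_zero_of_notMem_tsupport fun h => hx (tsupport_deriv_subset h)

/-- Integration by parts against a test function. -/
theorem integral_mul_deriv_add_deriv_mul_eq_zero {I : Set ℝ} (hI : IsOpen I) {u u' ψ : ℝ → ℝ}
    (hu : ∀ x ∈ I, HasDerivAt u (u' x) x) (hu' : ContinuousOn u' I) (hψ : ContDiff ℝ ∞ ψ)
    (hψc : HasCompactSupport ψ) (hψI : tsupport ψ ⊆ I) :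
    Integrable (fun x => u x * deriv ψ x) ∧ Integrable (fun x => u' x * ψ x) ∧
      ∫ x in I, (u x * deriv ψ x + u' x * ψ x) = 0 := by
  have hψd : Differentiable ℝ ψ := hψ.differentiable (by simp)
  have hdψ : Continuous (deriv ψ) := hψ.continuous_deriv (by simp)
  have hcu : ContinuousOn u I := fun x hx => (hu x hx).continuousAt.continuousWithinAt
  have hlu : LocallyIntegrableOn u I := hcu.locallyIntegrableOn hI.measurableSet
  have hlu' : LocallyIntegrableOn u' I := hu'.locallyIntegrableOn hI.measurableSet
  have h1 := integrable_mul_of_tsupport_subset hlu hdψ hψc.deriv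
    (tsupport_deriv_subset.trans hψI)
  have h2 := integrable_mul_of_tsupport_subset hlu' hψ.continuous hψc hψI
  have h3 := integrable_mul_of_tsupport_subset hlu hψ.continuous hψc hψI
  refine ⟨h1, h2, ?_⟩
  rw [setIntegral_eq_integral_of_tsupport_subset hψI fun x hx => by
    simp [deriv_eq_zero_of_notMem_tsupport hx, image_eq_zero_of_notMem_tsupport hx]]
  refine integral_eq_zero_of_hasDerivAt_of_integrable (f := fun x => u x * ψ x) (fun x => ?_)
    (h1.add h2) h3
  by_cases hx : x ∈ tsupport ψ
  · have := (hu x (hψI hx)).mul (hψd x).hasDerivAt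
    rwa [add_comm] at this
  · have hev : (fun x => u x * ψ x) =ᶠ[𝓝 x] fun _ => 0 := by
      filter_upwards [(isClosed_tsupport ψ).isOpen_compl.mem_nhds hx] with t ht
      simp [image_eq_zero_of_notMem_tsupport ht]
    have h0 : u x * deriv ψ x + u' x * ψ x = 0 := by
      simp [deriv_eq_zero_of_notMem_tsupport hx, image_eq_zero_of_notMem_tsupport hx]
    rw [h0]
    exact (hasDerivAt_const x (0 : ℝ)).congr_of_eventuallyEq hev

/-- A smooth compactly supported function of integral zero is the derivative of a smooth function
with compact support in the interval spanned by its support. -/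
theorem exists_testFunction_deriv_eq {θ : ℝ → ℝ} {A B : ℝ}
    (hθ : ContDiff ℝ ∞ θ) (hsupp : ∀ x, x ∉ Icc A B → θ x = 0) (hint : ∫ x, θ x = 0) :
    ∃ ψ : ℝ → ℝ, ContDiff ℝ ∞ ψ ∧ HasCompactSupport ψ ∧ tsupport ψ ⊆ Icc A B ∧ deriv ψ = θ := by
  have hc := hθ.continuous
  have hd : ∀ x, HasDerivAt (fun x => ∫ t in A..x, θ t) (θ x) x := fun x =>
    intervalIntegral.integral_hasDerivAt_right (hc.intervalIntegrable _ _)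
      hc.aestronglyMeasurable.stronglyMeasurableAtFilter hc.continuousAt
  have hderiv : deriv (fun x => ∫ t in A..x, θ t) = θ := funext fun x => (hd x).deriv
  have hzero : ∀ x, x ∉ Icc A B → ∫ t in A..x, θ t = 0 := by
    intro x hx
    rcases lt_or_ge x A with h | h
    · rw [intervalIntegral.integral_symm, neg_eq_zero, intervalIntegral.integral_of_le h.le]
      rw [← integral_Ico_eq_integral_Ioc]
      exact setIntegral_eq_zero_of_forall_eq_zero fun t ht =>
        hsupp t fun h' => absurd h'.1 (not_le.2 ht.2)
    · have hBx : B < x := by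
        by_contra! h'; exact hx ⟨h, h'⟩
      rw [intervalIntegral.integral_of_le h, ← hint, ← integral_Icc_eq_integral_Ioc]
      exact setIntegral_eq_integral_of_forall_compl_eq_zero fun t ht =>
        hsupp t fun h' => ht ⟨h'.1, h'.2.trans hBx.le⟩
  have hts : tsupport (fun x => ∫ t in A..x, θ t) ⊆ Icc A B := by
    refine closure_minimal (fun x hx => ?_) isClosed_Icc
    by_contra h
    exact hx (hzero x h)
  refine ⟨_, ?_, HasCompactSupport.of_support_subset_isCompact isCompact_Icc
    (subset_closure.trans hts), hts, hderiv⟩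
  rw [contDiff_infty_iff_deriv, hderiv]
  exact ⟨fun x => (hd x).differentiableAt, hθ⟩

/-- The lemma of du Bois-Reymond on an open interval. -/
theorem ae_eq_const_of_integral_mul_deriv_eq_zero {I : Set ℝ} (hI : IsOpen I)
    (hIc : I.OrdConnected) (hne : I.Nonempty) {Q : ℝ → ℝ} (hQ : LocallyIntegrableOn Q I)
    (h : ∀ ψ : ℝ → ℝ, ContDiff ℝ ∞ ψ → HasCompactSupport ψ → tsupport ψ ⊆ I →
      ∫ x in I, Q x * deriv ψ x = 0) :
    ∃ C, ∀ᵐ x, x ∈ I → Q x = C := by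
  obtain ⟨x0, hx0⟩ := hne
  obtain ⟨r, hr, hball⟩ := Metric.nhds_basis_closedBall.mem_iff.1 (hI.mem_nhds hx0)
  let b : ContDiffBump x0 := ⟨r / 2, r, by positivity, by linarith⟩
  set χ : ℝ → ℝ := b.normed volume with hχ
  have hχs : ContDiff ℝ ∞ χ := b.contDiff_normed
  have hχc : HasCompactSupport χ := b.hasCompactSupport_normed
  have hχt : tsupport χ = Metric.closedBall x0 r := b.tsupport_normed_eq
  have hχI : tsupport χ ⊆ I := hχt ▸ hball
  have hχint : ∫ x, χ x = 1 := b.integral_normed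
  have hQχ := integrable_mul_of_tsupport_subset hQ hχs.continuous hχc hχI
  set C := ∫ x, Q x * χ x with hC
  refine ⟨C, ?_⟩
  have hloc : LocallyIntegrableOn (fun x => Q x - C) I :=
    hQ.sub (continuous_const.locallyIntegrable.locallyIntegrableOn I)
  have key := hI.ae_eq_zero_of_integral_contDiff_smul_eq_zero hloc (fun η hη hηc hηI => ?_)
  · filter_upwards [key] with x hx hxI using sub_eq_zero.1 (hx hxI)
  set K := tsupport η ∪ tsupport χ with hK
  have hKc : IsCompact K := hηc.isCompact.union hχc.isCompact
  have hKI : K ⊆ I := union_subset hηI hχI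
  have hKne : K.Nonempty := ⟨x0, Or.inr (hχt ▸ Metric.mem_closedBall_self hr.le)⟩
  have hA := hKc.sInf_mem hKne
  have hB := hKc.sSup_mem hKne
  set A := sInf K
  set B := sSup K
  have hKAB : K ⊆ Icc A B := fun x hx => ⟨csInf_le hKc.bddBelow hx, le_csSup hKc.bddAbove hx⟩
  have hABI : Icc A B ⊆ I := hIc.out (hKI hA) (hKI hB)
  have hηint : Integrable η := hη.continuous.integrable_of_hasCompactSupport hηc
  have hχi : Integrable χ := hχs.continuous.integrable_of_hasCompactSupport hχc
  -- Subtracting `(∫ η) χ` makes the integral of `η` zero, so the difference is an admissible `ψ'`;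
  -- testing with `ψ` gives `∫ Q η = C ∫ η`.
  obtain ⟨ψ, hψ, hψc, hψt, hψd⟩ := exists_testFunction_deriv_eq (A := A) (B := B)
    (θ := fun x => η x - (∫ t, η t) * χ x) (hη.sub (contDiff_const.mul hχs))
    (fun x hx => by
      have hx' : x ∉ K := fun h => hx (hKAB h)
      rw [image_eq_zero_of_notMem_tsupport (f := η) fun h => hx' (Or.inl h),
        image_eq_zero_of_notMem_tsupport (f := χ) fun h => hx' (Or.inr h)]
      simp)
    (by
      rw [integral_sub hηint (hχi.const_mul _), integral_const_mul, hχint]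
      simp)
  have h1 := h ψ hψ hψc (hψt.trans hABI)
  rw [hψd, setIntegral_eq_integral_of_forall_compl_eq_zero fun x hx => ?_] at h1
  · have hQη := integrable_mul_of_tsupport_subset hQ hη.continuous hηc hηI
    have e1 : ∫ x, Q x * (η x - (∫ t, η t) * χ x)
        = (∫ x, Q x * η x) - (∫ t, η t) * C := by
      rw [hC, ← integral_const_mul, ← integral_sub hQη (hQχ.const_mul _)]
      congr 1; ext x; ring
    have e2 : ∫ x, η x • (Q x - C) = (∫ x, Q x * η x) - (∫ t, η t) * C := by
      rw [← integral_mul_const, ← integral_sub hQη (hηint.mul_const _)]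
      congr 1; ext x; simp only [smul_eq_mul]; ring
    rw [e2, ← e1, h1]
  · have hx' : x ∉ K := fun h => hx (hKI h)
    beta_reduce
    rw [image_eq_zero_of_notMem_tsupport (f := η) fun h => hx' (Or.inl h),
      image_eq_zero_of_notMem_tsupport (f := χ) fun h => hx' (Or.inr h)]
    simp

/-! ### Absolute continuity -/

theorem absolutelyContinuousOnInterval_of_dist_le {F φ : ℝ → ℝ} {a b K M : ℝ}
    (hφ : AbsolutelyContinuousOnInterval φ a b)
    (h : ∀ x ∈ uIcc a b, ∀ y ∈ uIcc a b, dist (F x) (F y) ≤ K * dist (φ x) (φ y) + M * dist x y) :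
    AbsolutelyContinuousOnInterval F a b := by
  have hid : AbsolutelyContinuousOnInterval (fun x : ℝ => x) a b :=
    (LipschitzWith.id.lipschitzOnWith (s := uIcc a b)).absolutelyContinuousOnInterval
  have hlim := (Tendsto.const_mul K hφ).add (Tendsto.const_mul M hid)
  simp only [mul_zero, add_zero] at hlim
  refine squeeze_zero' (Eventually.of_forall fun E => Finset.sum_nonneg fun _ _ => dist_nonneg)
    ?_ hlim
  filter_upwards [inf_le_right (a := AbsolutelyContinuousOnInterval.totalLengthFilter)
    (mem_principal_self (AbsolutelyContinuousOnInterval.disjWithin a b))] with E hE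
  rw [Finset.mul_sum, Finset.mul_sum, ← Finset.sum_add_distrib]
  exact Finset.sum_le_sum fun i hi => h _ (hE.1 i hi).1 _ (hE.1 i hi).2

theorem absolutelyContinuousOnInterval_of_integral_eq {F u : ℝ → ℝ} {a b : ℝ}
    (hu : IntervalIntegrable u volume a b)
    (h : ∀ x ∈ uIcc a b, F x - F a = ∫ t in a..x, u t) :
    AbsolutelyContinuousOnInterval F a b := by
  refine absolutelyContinuousOnInterval_of_dist_le (K := 1) (M := 0)
    (hu.absolutelyContinuousOnInterval_intervalIntegral left_mem_uIcc) fun x hx y hy => ?_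
  rw [← h x hx, ← h y hy, Real.dist_eq, Real.dist_eq]
  simp

theorem absolutelyContinuousOnInterval_comp_neg {F : ℝ → ℝ} {a b : ℝ}
    (h : AbsolutelyContinuousOnInterval F (-a) (-b)) :
    AbsolutelyContinuousOnInterval (fun x => F (-x)) a b := by
  have hneg : ∀ x ∈ uIcc a b, -x ∈ uIcc (-a) (-b) := by
    intro x hx
    rw [mem_uIcc] at hx ⊢
    rcases hx with hx | hx
    · right; constructor <;> linarith [hx.1, hx.2]
    · left; constructor <;> linarith [hx.1, hx.2]
  refine absolutelyContinuousOnInterval_of_integral_eq (u := fun t => -deriv F (-t)) ?_ ?_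
  · have := (IntervalIntegrable.comp_sub_left (f := deriv F) h.intervalIntegrable_deriv 0).neg
    simp only [zero_sub, neg_neg] at this
    exact this
  · intro x hx
    have h2 : AbsolutelyContinuousOnInterval F (-a) (-x) :=
      h.mono (uIcc_subset_uIcc left_mem_uIcc (hneg x hx))
    rw [intervalIntegral.integral_neg, intervalIntegral.integral_comp_neg,
      intervalIntegral.integral_symm, neg_neg, h2.integral_deriv_eq_sub]

/-- Monotonicity makes the derivative integrable, and differentiability at every point then gives
the fundamental theorem of calculus; differentiability almost everywhere would not suffice. -/
theorem absolutelyContinuousOnInterval_of_antitoneOn {φ : ℝ → ℝ} {a b : ℝ}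
    (hanti : AntitoneOn φ (uIcc a b)) (hd : ∀ x ∈ uIcc a b, DifferentiableAt ℝ φ x) :
    AbsolutelyContinuousOnInterval φ a b := by
  have hi : IntervalIntegrable (deriv φ) volume a b := by
    have := hanti.neg.intervalIntegrable_deriv.neg
    refine this.congr fun x _ => ?_
    simp
  refine absolutelyContinuousOnInterval_of_integral_eq hi fun x hx => ?_
  have hsub : uIcc a x ⊆ uIcc a b := uIcc_subset_uIcc left_mem_uIcc hx
  exact (intervalIntegral.integral_eq_sub_of_hasDerivAt
    (fun t ht => (hd t (hsub ht)).hasDerivAt) (hi.mono_set hsub)).symm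

/-! ### Admissible coefficients and the primitive of `D` -/

/-- What conditions (D) and (D̃), together with (g), have in common. -/
structure IsAdmissible (R : ℝ) (f D g : ℝ → ℝ) : Prop where
  R_pos : 0 < R
  f_contDiff : ContDiffOn ℝ 1 f (Icc 0 R)
  f_zero : f 0 = 0
  g_cont : ContinuousOn g (Icc 0 R)
  g_pos : ∀ s ∈ Ico 0 R, 0 < g s
  g_zero : g R = 0
  D_cont : ContinuousOn D (Icc 0 R)
  D_zero : D R = 0
  D_pos : ∀ s ∈ Ioo 0 R, 0 < D s

theorem isAdmissible_of_cond {R : ℝ} {f D g : ℝ → ℝ} (hR : 0 < R) (hs : Standing R f g)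
    (hg : CondG R g) (hD : CondD R D ∨ CondDTilde R D g) : IsAdmissible R f D g where
  R_pos := hR
  f_contDiff := hs.f_contDiff
  f_zero := hs.f_zero
  g_cont := hs.g_continuous
  g_pos := hg.pos
  g_zero := hg.zero
  D_cont := hD.elim (fun h => h.contDiff.continuousOn) (fun h => h.continuous)
  D_zero := hD.elim (fun h => h.zero) (fun h => h.zero)
  D_pos := hD.elim (fun h => h.pos) (fun h => h.pos)

/-- The primitive of `D` that vanishes at `0`. -/
def primD (D : ℝ → ℝ) (x : ℝ) : ℝ := ∫ s in (0 : ℝ)..x, D s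

namespace IsAdmissible

variable {R : ℝ} {f D g : ℝ → ℝ} (A : IsAdmissible R f D g)
include A

theorem zero_mem : (0 : ℝ) ∈ Icc 0 R := left_mem_Icc.2 A.R_pos.le

theorem R_mem : R ∈ Icc 0 R := right_mem_Icc.2 A.R_pos.le

theorem D_nonneg : ∀ s ∈ Icc 0 R, 0 ≤ D s := by
  have : Icc 0 R ⊆ closure (Ioo 0 R) := by rw [closure_Ioo A.R_pos.ne]
  intro s hs
  have : (𝓝[Ioo 0 R] s).NeBot := mem_closure_iff_nhdsWithin_neBot.1 (this hs)
  exact ge_of_tendsto ((A.D_cont s hs).mono_left (nhdsWithin_mono s Ioo_subset_Icc_self))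
    (eventually_nhdsWithin_of_forall fun t ht => (A.D_pos t ht).le)

theorem g_nonneg : ∀ s ∈ Icc 0 R, 0 ≤ g s := by
  intro s hs
  rcases hs.2.eq_or_lt with rfl | h
  · exact A.g_zero.ge
  · exact (A.g_pos s ⟨hs.1, h⟩).le

theorem advSpeed_cont : ContinuousOn (advSpeed R f) (Icc 0 R) :=
  A.f_contDiff.continuousOn_derivWithin (uniqueDiffOn_Icc A.R_pos) le_rfl

theorem f_hasDerivWithinAt {s : ℝ} (hs : s ∈ Icc 0 R) :
    HasDerivWithinAt f (advSpeed R f s) (Icc 0 R) s :=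
  (A.f_contDiff.differentiableOn one_ne_zero s hs).hasDerivWithinAt

theorem f_hasDerivAt {s : ℝ} (hs : s ∈ Ioo 0 R) : HasDerivAt f (advSpeed R f s) s :=
  (A.f_hasDerivWithinAt (Ioo_subset_Icc_self hs)).hasDerivAt (Icc_mem_nhds hs.1 hs.2)

theorem D_intervalIntegrable {a b : ℝ} (ha : a ∈ Icc 0 R) (hb : b ∈ Icc 0 R) :
    IntervalIntegrable D volume a b :=
  (A.D_cont.mono (ordConnected_Icc.uIcc_subset ha hb)).intervalIntegrable

theorem primD_sub {a b : ℝ} (ha : a ∈ Icc 0 R) (hb : b ∈ Icc 0 R) :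
    primD D b - primD D a = ∫ s in a..b, D s :=
  intervalIntegral.integral_interval_sub_left (A.D_intervalIntegrable A.zero_mem hb)
    (A.D_intervalIntegrable A.zero_mem ha)

theorem primD_hasStrictDerivAt {s : ℝ} (hs : s ∈ Ioo 0 R) :
    HasStrictDerivAt (primD D) (D s) s :=
  intervalIntegral.integral_hasStrictDerivAt_right
    (A.D_intervalIntegrable A.zero_mem (Ioo_subset_Icc_self hs))
    ((A.D_cont.mono Ioo_subset_Icc_self).stronglyMeasurableAtFilter isOpen_Ioo s hs)
    (A.D_cont.continuousAt (Icc_mem_nhds hs.1 hs.2))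

theorem primD_cont : ContinuousOn (primD D) (Icc 0 R) :=
  intervalIntegral.continuousOn_primitive_interval
    ((uIcc_of_le A.R_pos.le).symm ▸ A.D_cont.integrableOn_Icc) |>.mono
      (uIcc_of_le A.R_pos.le).ge

/-- This makes `primD` a change of variable on the densities even though `D` degenerates at the
ends. Order relations for `φ` can then be read off `primD D ∘ φ`, which stays differentiable where
`φ` is not. -/
theorem primD_strictMono : StrictMonoOn (primD D) (Icc 0 R) :=
  strictMonoOn_of_hasDerivWithinAt_pos (f' := D) (convex_Icc _ _) A.primD_cont
    (fun s hs => by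
      rw [interior_Icc] at hs
      exact (A.primD_hasStrictDerivAt hs).hasDerivAt.hasDerivWithinAt)
    (fun s hs => by rw [interior_Icc] at hs; exact A.D_pos s hs)

theorem primD_nonneg {s : ℝ} (hs : s ∈ Icc 0 R) : 0 ≤ primD D s := by
  have := A.primD_strictMono.monotoneOn A.zero_mem hs hs.1
  simpa [primD] using this

theorem f_lipschitz : ∃ K : NNReal, LipschitzOnWith K f (Icc 0 R) :=
  A.f_contDiff.exists_lipschitzOnWith one_ne_zero (convex_Icc _ _) isCompact_Icc

end IsAdmissible

/-! ### The integrated wave equation -/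

/-- The integrated form of the traveling-wave equation: `Z` is the continuous version of the
diffusive term. -/
structure IsIntegratedWave (R : ℝ) (f D g : ℝ → ℝ) (c : ℝ) (I : Set ℝ) (φ Z : ℝ → ℝ) : Prop where
  isOpen : IsOpen I
  ordConnected : I.OrdConnected
  mapsTo : MapsTo φ I (Icc 0 R)
  continuous : ContinuousOn φ I
  hasDerivAt : ∀ ξ ∈ I, HasDerivAt (fun η => primD D (φ η)) (Z ξ) ξ
  balance : ∀ a ∈ I, ∀ b ∈ I,
    Z b - Z a = (f (φ b) - c * φ b) - (f (φ a) - c * φ a) - ∫ ξ in a..b, g (φ ξ)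

/-- With `G` a primitive of `g(φ)`, integration by parts puts the whole weak equation on `ψ'`, and
du Bois-Reymond makes `D(φ) φ' - f(φ) + c φ + G` constant a.e. Solving for the flux yields the
continuous `Z`; `flux_weak` then promotes the a.e. identity to a derivative at every point. -/
theorem IsTravelingWave.exists_isIntegratedWave {R : ℝ} {f D g : ℝ → ℝ} (A : IsAdmissible R f D g)
    {c : ℝ} {I : Set ℝ} {φ : ℝ → ℝ} (hne : I.Nonempty) (h : IsTravelingWave R f D g c I φ) :
    ∃ Z, IsIntegratedWave R f D g c I φ Z := by
  obtain ⟨x0, hx0⟩ := hne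
  have hgφ : ContinuousOn (fun ξ => g (φ ξ)) I := A.g_cont.comp h.continuous h.mapsTo
  have hfφ : ContinuousOn (fun ξ => f (φ ξ)) I := A.f_contDiff.continuousOn.comp h.continuous h.mapsTo
  have hgi : ∀ a ∈ I, ∀ b ∈ I, IntervalIntegrable (fun ξ => g (φ ξ)) volume a b :=
    fun a ha b hb => (hgφ.mono (h.ordConnected.uIcc_subset ha hb)).intervalIntegrable
  set G : ℝ → ℝ := fun ξ => ∫ t in x0..ξ, g (φ t) with hG
  have hGd : ∀ ξ ∈ I, HasDerivAt G (g (φ ξ)) ξ := fun ξ hξ =>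
    intervalIntegral.integral_hasDerivAt_right (hgi x0 hx0 ξ hξ)
      (hgφ.stronglyMeasurableAtFilter h.isOpen ξ hξ) (hgφ.continuousAt (h.isOpen.mem_nhds hξ))
  have hGc : ContinuousOn G I := fun ξ hξ => (hGd ξ hξ).continuousAt.continuousWithinAt
  have hPloc : LocallyIntegrableOn (fun ξ => flux D φ ξ - f (φ ξ) + c * φ ξ) I :=
    (h.flux_locallyIntegrable.sub (hfφ.locallyIntegrableOn h.isOpen.measurableSet)).add
      ((h.continuous.const_mul c).locallyIntegrableOn h.isOpen.measurableSet)
  obtain ⟨C, hC⟩ := ae_eq_const_of_integral_mul_deriv_eq_zero h.isOpen h.ordConnected ⟨x0, hx0⟩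
    (Q := fun ξ => (flux D φ ξ - f (φ ξ) + c * φ ξ) + G ξ)
    (hPloc.add (hGc.locallyIntegrableOn h.isOpen.measurableSet)) (fun ψ hψ hψc hψI => by
      obtain ⟨i1, i2, e⟩ := integral_mul_deriv_add_deriv_mul_eq_zero h.isOpen hGd hgφ hψ hψc hψI
      have i0 := integrable_mul_of_tsupport_subset hPloc (hψ.continuous_deriv (by simp))
        hψc.deriv (tsupport_deriv_subset.trans hψI)
      have w := h.weak_eq ψ hψ hψc hψI
      have := integral_add ((i0.sub i2).integrableOn (s := I)) ((i1.add i2).integrableOn (s := I))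
      simp only [Pi.sub_apply, Pi.add_apply] at this
      rw [e, w] at this
      rw [add_zero] at this
      rw [← this]
      congr 1; ext ξ; ring)
  set Z : ℝ → ℝ := fun ξ => C + (f (φ ξ) - c * φ ξ) - G ξ with hZ
  have hZc : ContinuousOn Z I := (continuousOn_const.add (hfφ.sub (h.continuous.const_mul c))).sub hGc
  refine ⟨Z, h.isOpen, h.ordConnected, h.mapsTo, h.continuous, fun ξ hξ => ?_, fun a ha b hb => ?_⟩
  · have hZi : ∀ b ∈ I, IntervalIntegrable Z volume x0 b := fun b hb =>
      (hZc.mono (h.ordConnected.uIcc_subset hx0 hb)).intervalIntegrable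
    have hZd : HasDerivAt (fun ξ => ∫ t in x0..ξ, Z t) (Z ξ) ξ :=
      intervalIntegral.integral_hasDerivAt_right (hZi ξ hξ)
        (hZc.stronglyMeasurableAtFilter h.isOpen ξ hξ) (hZc.continuousAt (h.isOpen.mem_nhds hξ))
    refine (hZd.const_add (primD D (φ x0))).congr_of_eventuallyEq ?_
    filter_upwards [h.isOpen.mem_nhds hξ] with η hη
    have e1 := h.flux_weak x0 hx0 η hη
    rw [← A.primD_sub (h.mapsTo hx0) (h.mapsTo hη)] at e1
    have e2 : ∫ ξ in x0..η, flux D φ ξ = ∫ ξ in x0..η, Z ξ := by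
      refine intervalIntegral.integral_congr_ae ?_
      filter_upwards [hC] with t ht hts
      have := ht (h.ordConnected.uIcc_subset hx0 hη (uIoc_subset_uIcc hts))
      simp only [hZ]
      linarith
    rw [← e2, ← e1]; ring
  · simp only [hZ, hG]
    have := intervalIntegral.integral_interval_sub_left (hgi x0 hx0 b hb) (hgi x0 hx0 a ha)
    linarith

namespace IsIntegratedWave

variable {R : ℝ} {f D g : ℝ → ℝ} {c : ℝ} {I : Set ℝ} {φ Z : ℝ → ℝ}

/-- At interior densities `D > 0`, so the inverse function theorem recovers `φ` from the
differentiable function `primD D ∘ φ`. -/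
theorem phi_hasDerivAt (h : IsIntegratedWave R f D g c I φ Z) (A : IsAdmissible R f D g) {ξ : ℝ}
    (hξ : ξ ∈ I) (hφ : φ ξ ∈ Ioo 0 R) : HasDerivAt φ (Z ξ / D (φ ξ)) ξ := by
  have hs := A.primD_hasStrictDerivAt hφ
  have hD := (A.D_pos _ hφ).ne'
  have h1 := ((hs.to_localInverse hD).hasDerivAt).comp ξ (h.hasDerivAt ξ hξ)
  rw [inv_mul_eq_div] at h1
  refine h1.congr_of_eventuallyEq ?_
  have hev := (hs.hasStrictFDerivAt_equiv hD).eventually_left_inverse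
  have := (h.continuous.continuousAt (h.isOpen.mem_nhds hξ)).eventually hev
  filter_upwards [this] with η hη using hη.symm

theorem Z_continuous (h : IsIntegratedWave R f D g c I φ Z) (A : IsAdmissible R f D g) :
    ContinuousOn Z I := by
  have hgφ : ContinuousOn (fun ξ => g (φ ξ)) I := A.g_cont.comp h.continuous h.mapsTo
  intro ξ hξ
  have hG : ContinuousAt (fun η => ∫ t in ξ..η, g (φ t)) ξ :=
    (intervalIntegral.integral_hasDerivAt_right (by simp)
      (hgφ.stronglyMeasurableAtFilter h.isOpen ξ hξ)
      (hgφ.continuousAt (h.isOpen.mem_nhds hξ))).continuousAt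
  have hfφ : ContinuousOn (fun ξ => f (φ ξ)) I :=
    A.f_contDiff.continuousOn.comp h.continuous h.mapsTo
  have hc : ContinuousWithinAt (fun η => Z ξ + ((f (φ η) - c * φ η) - (f (φ ξ) - c * φ ξ)
      - ∫ t in ξ..η, g (φ t))) I ξ :=
    continuousWithinAt_const.add ((((hfφ ξ hξ).sub ((h.continuous ξ hξ).const_mul c)).sub
      continuousWithinAt_const).sub hG.continuousWithinAt)
  refine hc.congr_of_mem (fun η hη => ?_) hξ
  rw [← h.balance ξ hξ η hη]; ring

theorem Z_hasDerivAt (h : IsIntegratedWave R f D g c I φ Z) (A : IsAdmissible R f D g) {ξ : ℝ}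
    (hξ : ξ ∈ I) (hφ : φ ξ ∈ Ioo 0 R) :
    HasDerivAt Z ((advSpeed R f (φ ξ) - c) * (Z ξ / D (φ ξ)) - g (φ ξ)) ξ := by
  have hgφ : ContinuousOn (fun ξ => g (φ ξ)) I := A.g_cont.comp h.continuous h.mapsTo
  have hG : HasDerivAt (fun η => ∫ t in ξ..η, g (φ t)) (g (φ ξ)) ξ :=
    intervalIntegral.integral_hasDerivAt_right (by simp)
      (hgφ.stronglyMeasurableAtFilter h.isOpen ξ hξ)
      (hgφ.continuousAt (h.isOpen.mem_nhds hξ))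
  have hd := h.phi_hasDerivAt A hξ hφ
  have hf := (A.f_hasDerivAt hφ).comp ξ hd
  have := ((((hf.sub (hd.const_mul c)).sub_const (f (φ ξ) - c * φ ξ)).sub hG).const_add (Z ξ))
  rw [← sub_mul] at this
  refine this.congr_of_eventuallyEq ?_
  filter_upwards [h.isOpen.mem_nhds hξ] with η hη
  have := h.balance ξ hξ η hη
  simp only [Pi.sub_apply, Function.comp_apply]
  linarith

/-- Where `φ` attains an extreme value the diffusive term vanishes. -/
theorem Z_eq_zero_of_eq_zero (h : IsIntegratedWave R f D g c I φ Z) (A : IsAdmissible R f D g)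
    {ξ : ℝ} (hξ : ξ ∈ I) (hφ : φ ξ = 0) : Z ξ = 0 := by
  refine IsLocalMin.hasDerivAt_eq_zero ?_ (h.hasDerivAt ξ hξ)
  filter_upwards [h.isOpen.mem_nhds hξ] with η hη
  rw [hφ]
  exact A.primD_strictMono.monotoneOn A.zero_mem (h.mapsTo hη) (h.mapsTo hη).1

theorem Z_eq_zero_of_eq_R (h : IsIntegratedWave R f D g c I φ Z) (A : IsAdmissible R f D g)
    {ξ : ℝ} (hξ : ξ ∈ I) (hφ : φ ξ = R) : Z ξ = 0 := by
  refine IsLocalMax.hasDerivAt_eq_zero ?_ (h.hasDerivAt ξ hξ)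
  filter_upwards [h.isOpen.mem_nhds hξ] with η hη
  rw [hφ]
  exact A.primD_strictMono.monotoneOn (h.mapsTo hη) A.R_mem (h.mapsTo hη).2

end IsIntegratedWave

/-! ### The phase function and the rigidity of waves -/

/-- `y` solves the first-order problem for (minus) the diffusive term as a function of the
density. -/
structure IsPhase (R : ℝ) (f D g : ℝ → ℝ) (c : ℝ) (y : ℝ → ℝ) : Prop where
  continuous : ContinuousOn y (Ioc 0 R)
  terminal : y R = 0
  pos : ∀ s ∈ Ioo 0 R, 0 < y s
  hasDerivAt : ∀ s ∈ Ioo 0 R, HasDerivAt y (c - advSpeed R f s - D s * g s / y s) s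
  bounded : ∃ M, ∀ s ∈ Ioc 0 R, y s ≤ M

theorem IsAdmissible.exists_isPhase {R : ℝ} {f D g : ℝ → ℝ} (A : IsAdmissible R f D g) (c : ℝ) :
    ∃ y, IsPhase R f D g c y := by
  obtain ⟨y, h1, h2, h3, h4, h5⟩ := exists_singular_solution (κ := fun s => c - advSpeed R f s)
    (p := fun s => D s * g s) A.R_pos (continuousOn_const.sub A.advSpeed_cont)
    (A.D_cont.mul A.g_cont) (fun s hs => mul_nonneg (A.D_nonneg s hs) (A.g_nonneg s hs))
    (fun s hs => mul_pos (A.D_pos s hs) (A.g_pos s ⟨hs.1.le, hs.2⟩))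
  exact ⟨y, h1, h2, h3, h4, h5⟩

section Wave

variable {R : ℝ} {f D g : ℝ → ℝ} {c : ℝ} {φ Z y : ℝ → ℝ} {w : ℝ}

theorem IsIntegratedWave.mono {I J : Set ℝ} (h : IsIntegratedWave R f D g c I φ Z)
    (hJ : IsOpen J) (hJc : J.OrdConnected) (hJI : J ⊆ I) : IsIntegratedWave R f D g c J φ Z where
  isOpen := hJ
  ordConnected := hJc
  mapsTo := h.mapsTo.mono_left hJI
  continuous := h.continuous.mono hJI
  hasDerivAt := fun ξ hξ => h.hasDerivAt ξ (hJI hξ)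
  balance := fun a ha b hb => h.balance a (hJI ha) b (hJI hb)

/-- A decreasing profile does not vanish. -/
theorem IsIntegratedWave.pos_of_antitoneOn (h : IsIntegratedWave R f D g c (Iio w) φ Z)
    (A : IsAdmissible R f D g) (hanti : AntitoneOn φ (Iio w)) : ∀ ξ < w, 0 < φ ξ := by
  intro ξ hξ
  refine (h.mapsTo hξ).1.lt_of_ne' fun h0 => ?_
  obtain ⟨b, hξb, hb⟩ := exists_between hξ
  -- By monotonicity a zero persists, and the balance over `[ξ, b]` would read `0 = -(b - ξ) g(0)`.
  have hz : ∀ η ∈ Icc ξ b, φ η = 0 := fun η hη =>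
    le_antisymm (h0 ▸ hanti hξ (hη.2.trans_lt hb) hη.1) (h.mapsTo (hη.2.trans_lt hb)).1
  have e := h.balance ξ hξ b hb
  have hint : ∫ t in ξ..b, g (φ t) = ∫ t in ξ..b, g 0 :=
    intervalIntegral.integral_congr fun t ht => by
      rw [uIcc_of_le hξb.le] at ht
      simp only [hz t ht]
  rw [h.Z_eq_zero_of_eq_zero A hξ h0, h.Z_eq_zero_of_eq_zero A hb (hz b ⟨hξb.le, le_rfl⟩), h0,
    hz b ⟨hξb.le, le_rfl⟩, hint, intervalIntegral.integral_const, smul_eq_mul] at e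
  have := mul_pos (sub_pos.2 hξb) (A.g_pos 0 ⟨le_rfl, A.R_pos⟩)
  linarith

theorem IsIntegratedWave.Z_nonpos_of_antitoneOn {I : Set ℝ}
    (h : IsIntegratedWave R f D g c I φ Z)
    (A : IsAdmissible R f D g) (hanti : AntitoneOn φ I) : ∀ ξ ∈ I, Z ξ ≤ 0 := by
  intro ξ hξ
  have h1 : AntitoneOn (fun η => primD D (φ η)) I := fun a ha b hb hab =>
    A.primD_strictMono.monotoneOn (h.mapsTo hb) (h.mapsTo ha) (hanti ha hb hab)
  have h2 := h1.derivWithin_nonpos (x := ξ)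
  rwa [derivWithin_of_isOpen h.isOpen hξ, (h.hasDerivAt ξ hξ).deriv] at h2

/-- The deviation of the diffusive term from the phase function solves a linear equation. -/
theorem IsIntegratedWave.deviation_hasDerivAt {I : Set ℝ} (h : IsIntegratedWave R f D g c I φ Z)
    (A : IsAdmissible R f D g) (hy : IsPhase R f D g c y) {ξ : ℝ} (hξ : ξ ∈ I)
    (hφ : φ ξ ∈ Ioo 0 R) :
    HasDerivAt (fun η => Z η + y (φ η)) (-(g (φ ξ) / y (φ ξ)) * (Z ξ + y (φ ξ))) ξ := by
  have h1 := (h.Z_hasDerivAt A hξ hφ).add ((hy.hasDerivAt _ hφ).comp ξ (h.phi_hasDerivAt A hξ hφ))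
  have hD := (A.D_pos _ hφ).ne'
  have hy0 := (hy.pos _ hφ).ne'
  refine h1.congr_deriv ?_
  field_simp
  ring

/-- The linear equation damps, because `g / y ≥ 0`: a zero of the deviation propagates forward, a
nonzero value backward. The end points of `S` may have density `R`, where only the continuity of `y`
is needed. -/
theorem IsIntegratedWave.deviation_sq_antitoneOn {I S : Set ℝ}
    (h : IsIntegratedWave R f D g c I φ Z) (A : IsAdmissible R f D g) (hy : IsPhase R f D g c y)
    (hS : Convex ℝ S) (hSI : S ⊆ I) (hpos : ∀ ξ ∈ S, 0 < φ ξ)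
    (hlt : ∀ ξ ∈ interior S, φ ξ < R) : AntitoneOn (fun η => (Z η + y (φ η)) ^ 2) S := by
  have hin : ∀ ξ ∈ interior S, φ ξ ∈ Ioo 0 R := fun ξ hξ =>
    ⟨hpos ξ (interior_subset hξ), hlt ξ hξ⟩
  refine antitoneOn_of_hasDerivWithinAt_nonpos hS
    (f' := fun ξ => 2 * (Z ξ + y (φ ξ)) * (-(g (φ ξ) / y (φ ξ)) * (Z ξ + y (φ ξ)))) ?_ ?_ ?_
  · exact (((h.Z_continuous A).mono hSI).add (hy.continuous.comp (h.continuous.mono hSI)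
      fun ξ hξ => ⟨hpos ξ hξ, (h.mapsTo (hSI hξ)).2⟩)).pow 2
  · intro ξ hξ
    have := (h.deviation_hasDerivAt A hy (hSI (interior_subset hξ)) (hin ξ hξ)).pow 2
    simp only [Nat.cast_ofNat, Nat.add_one_sub_one, pow_one] at this
    exact this.hasDerivWithinAt
  · intro ξ hξ
    have h1 : 0 ≤ g (φ ξ) / y (φ ξ) :=
      div_nonneg (A.g_nonneg _ (Ioo_subset_Icc_self (hin ξ hξ))) (hy.pos _ (hin ξ hξ)).le
    have := mul_nonneg h1 (sq_nonneg (Z ξ + y (φ ξ)))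
    linarith

/-- Along a decreasing profile from `R` the diffusive term is given by the phase function. -/
theorem IsIntegratedWave.Z_eq_neg_phase (h : IsIntegratedWave R f D g c (Iio w) φ Z)
    (A : IsAdmissible R f D g) (hy : IsPhase R f D g c y) (hanti : AntitoneOn φ (Iio w))
    (hlim : Tendsto φ atBot (𝓝 R)) : ∀ ξ < w, Z ξ = -y (φ ξ) := by
  intro ξ hξ
  have hpos := h.pos_of_antitoneOn A hanti
  have hle : ∀ η < w, φ η ≤ R := fun η hη => (h.mapsTo hη).2
  suffices hE : Z ξ + y (φ ξ) = 0 by linarith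
  by_cases hex : ∃ η ≤ ξ, φ η = R
  -- The deviation vanishes at the last point `a ≤ ξ` with density `R`, since `Z a = 0` and `y R =
  -- 0`; damping carries this to `ξ`.
  · set S := Iic ξ ∩ φ ⁻¹' {R} with hS
    have hcl : IsClosed S := (h.continuous.mono (Iic_subset_Iio.2 hξ)).preimage_isClosed_of_isClosed
      isClosed_Iic isClosed_singleton
    have hne : S.Nonempty := hex
    have hbd : BddAbove S := ⟨ξ, fun x hx => hx.1⟩
    have ha : sSup S ∈ S := hcl.csSup_mem hne hbd
    set a := sSup S
    have haξ : a ≤ ξ := ha.1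
    have hφa : φ a = R := ha.2
    have hanti2 := h.deviation_sq_antitoneOn A hy (S := Icc a ξ) (convex_Icc a ξ)
      (fun x hx => hx.2.trans_lt hξ) (fun x hx => hpos x (hx.2.trans_lt hξ)) (fun x hx => by
        rw [interior_Icc] at hx
        refine (hle x (hx.2.trans hξ)).lt_of_ne fun hxR => ?_
        exact absurd (le_csSup hbd (⟨hx.2.le, hxR⟩ : x ∈ S)) (not_le.2 hx.1))
    have := hanti2 (left_mem_Icc.2 haξ) (right_mem_Icc.2 haξ) haξ
    simp only [hφa, hy.terminal, h.Z_eq_zero_of_eq_R A (haξ.trans_lt hξ) hφa] at this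
    nlinarith [sq_nonneg (Z ξ + y (φ ξ))]
  · push Not at hex
    have hlt : ∀ η ≤ ξ, φ η < R := fun η hη => (hle η (hη.trans_lt hξ)).lt_of_ne (hex η hη)
    have hanti2 := h.deviation_sq_antitoneOn A hy (S := Iic ξ) (convex_Iic ξ)
      (Iic_subset_Iio.2 hξ) (fun x hx => hpos x (lt_of_le_of_lt hx hξ))
      (fun x hx => hlt x (interior_subset (s := Iic ξ) hx))
    by_contra hne
    -- A nonzero deviation keeps size at least `e` back to `-∞`. There `y(φ) → 0` and `Z ≤ 0`, which
    -- leaves only `Z ≤ -e`.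
    set e := |Z ξ + y (φ ξ)| with he
    have hepos : 0 < e := abs_pos.2 hne
    have hφ' : Tendsto φ atBot (𝓝[Ioc 0 R] R) := by
      refine tendsto_nhdsWithin_iff.2 ⟨hlim, ?_⟩
      filter_upwards [Iic_mem_atBot ξ] with η hη
      exact ⟨hpos η (lt_of_le_of_lt hη hξ), (hlt η hη).le⟩
    have hyφ : Tendsto (fun η => y (φ η)) atBot (𝓝 0) := by
      have := (hy.continuous R ⟨A.R_pos, le_rfl⟩).tendsto.comp hφ'
      rwa [hy.terminal] at this
    obtain ⟨η₁, hη₁⟩ := eventually_atBot.1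
      ((hyφ.eventually (gt_mem_nhds hepos)).and (Iic_mem_atBot ξ))
    have hZ : ∀ η ≤ η₁, Z η ≤ -e := by
      intro η hη
      have hηξ : η ≤ ξ := (hη₁ η hη).2
      have hηw : η < w := hηξ.trans_lt hξ
      have h1 : e ^ 2 ≤ (Z η + y (φ η)) ^ 2 := by
        rw [he, sq_abs]; exact hanti2 hηξ (mem_Iic.2 le_rfl) hηξ
      have h2 : e ≤ |Z η + y (φ η)| := by
        rw [← abs_of_pos hepos]; exact sq_le_sq.1 h1
      have h3 := h.Z_nonpos_of_antitoneOn A hanti η hηw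
      have h4 := hy.pos (φ η) ⟨hpos η hηw, hlt η hηξ⟩
      have h5 := (hη₁ η hη).1
      rcases le_abs.1 h2 with h6 | h6 <;> linarith
    have hη₁w : η₁ < w := (hη₁ η₁ le_rfl).2.trans_lt hξ
    set L := primD D R
    have hLpos : 0 ≤ L := A.primD_nonneg A.R_mem
    -- Over this length `primD D ∘ φ` drops by at least `L + 1`, although its values lie in `[0,
    -- L]`.
    set η₂ := η₁ - (L + 1) / e with hη₂
    have h21 : η₂ ≤ η₁ := by rw [hη₂]; linarith [div_pos (by linarith : (0 : ℝ) < L + 1) hepos]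
    have hb := Convex.image_sub_le_mul_sub_of_deriv_le (convex_Icc η₂ η₁)
      (f := fun η => primD D (φ η)) (C := -e)
      (fun x hx => (h.hasDerivAt x (hx.2.trans_lt hη₁w)).continuousAt.continuousWithinAt)
      (fun x hx => (h.hasDerivAt x ((interior_subset hx).2.trans_lt
        hη₁w)).differentiableAt.differentiableWithinAt)
      (fun x hx => by
        have hx' := interior_subset hx
        rw [(h.hasDerivAt x (hx'.2.trans_lt hη₁w)).deriv]
        exact hZ x hx'.2) η₂ (left_mem_Icc.2 h21) η₁ (right_mem_Icc.2 h21) h21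
    have e1 : e * (η₁ - η₂) = L + 1 := by rw [hη₂]; field_simp; ring
    have e2 := A.primD_nonneg (h.mapsTo hη₁w)
    have e3 : primD D (φ η₂) ≤ L := A.primD_strictMono.monotoneOn
      (h.mapsTo (h21.trans_lt hη₁w)) A.R_mem (hle η₂ (h21.trans_lt hη₁w))
    linarith

/-- Once the diffusive term of a wave is negative at a density below `R`, it stays negative, and
the density decreases, as long as the density is positive. -/
theorem IsIntegratedWave.Z_neg_of_pos (h : IsIntegratedWave R f D g c univ φ Z)
    (A : IsAdmissible R f D g) {ξ₀ b : ℝ} (hZ : Z ξ₀ < 0) (hR : φ ξ₀ < R)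
    (hpos : ∀ ξ ∈ Ico ξ₀ b, 0 < φ ξ) :
    ∀ ξ ∈ Ico ξ₀ b, Z ξ < 0 ∧ φ ξ ≤ φ ξ₀ := by
  have hZc : Continuous Z := continuousOn_univ.1 (h.Z_continuous A)
  have hle : ∀ ξ, ξ₀ ≤ ξ → (∀ t ∈ Ioo ξ₀ ξ, Z t ≤ 0) → φ ξ ≤ φ ξ₀ := by
    intro ξ hξ hneg
    have hanti : AntitoneOn (fun η => primD D (φ η)) (Icc ξ₀ ξ) :=
      antitoneOn_of_hasDerivWithinAt_nonpos (f' := Z) (convex_Icc _ _)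
        (fun x _ => (h.hasDerivAt x trivial).continuousAt.continuousWithinAt)
        (fun x _ => (h.hasDerivAt x trivial).hasDerivWithinAt)
        (fun x hx => by rw [interior_Icc] at hx; exact hneg x hx)
    exact (A.primD_strictMono.le_iff_le (h.mapsTo trivial) (h.mapsTo trivial)).1
      (hanti (left_mem_Icc.2 hξ) (right_mem_Icc.2 hξ) hξ)
  have hneg : ∀ ξ ∈ Ico ξ₀ b, Z ξ < 0 := by
    intro ξ hξ
    by_contra! hcon
    set S := Icc ξ₀ ξ ∩ Z ⁻¹' Ici 0 with hS
    have hcl : IsClosed S := isClosed_Icc.inter (isClosed_Ici.preimage hZc)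
    have hbd : BddBelow S := ⟨ξ₀, fun x hx => hx.1.1⟩
    have hτ : sInf S ∈ S := hcl.csInf_mem ⟨ξ, ⟨hξ.1, le_rfl⟩, hcon⟩ hbd
    set τ := sInf S
    have hlt : ∀ x ∈ Ico ξ₀ τ, Z x < 0 := by
      intro x hx
      by_contra! hx0
      exact absurd (csInf_le hbd (⟨⟨hx.1, hx.2.le.trans hτ.1.2⟩, hx0⟩ : x ∈ S)) (not_le.2 hx.2)
    have hτ0 : 0 ≤ Z τ := hτ.2
    have hξτ : ξ₀ < τ := hτ.1.1.lt_of_ne fun he => by rw [← he] at hτ0; linarith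
    have hev : ∀ᶠ x in 𝓝[<] τ, Z x < 0 := by
      filter_upwards [Ioo_mem_nhdsLT hξτ] with x hx using hlt x ⟨hx.1.le, hx.2⟩
    have hZτ : Z τ = 0 :=
      le_antisymm (le_of_tendsto (hZc.continuousAt.tendsto.mono_left nhdsWithin_le_nhds)
        (hev.mono fun x hx => hx.le)) hτ0
    have hφτ : φ τ ∈ Ioo 0 R :=
      ⟨hpos τ ⟨hξτ.le, hτ.1.2.trans_lt hξ.2⟩,
        (hle τ hξτ.le fun t ht => (hlt t ⟨ht.1.le, ht.2⟩).le).trans_lt hR⟩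
    -- At the first zero `τ` of `Z` the equation gives `Z' = -g(φ) < 0`, whereas an approach from
    -- negative values requires `Z' ≥ 0`.
    have hd := h.Z_hasDerivAt A (ξ := τ) trivial hφτ
    rw [hZτ, zero_div, mul_zero, zero_sub] at hd
    have hgpos := A.g_pos _ ⟨hφτ.1.le, hφτ.2⟩
    have hslope := (hasDerivAt_iff_tendsto_slope.1 hd).mono_left
      (nhdsWithin_mono τ (fun x hx => ne_of_lt hx : Iio τ ⊆ {τ}ᶜ))
    have : 0 ≤ -g (φ τ) := by
      refine ge_of_tendsto hslope ?_
      filter_upwards [hev, self_mem_nhdsWithin] with x hx hxτ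
      rw [slope_def_field, hZτ]
      exact div_nonneg_of_nonpos (by linarith) (sub_nonpos.2 (le_of_lt hxτ))
    linarith
  exact fun ξ hξ => ⟨hneg ξ hξ, hle ξ hξ.1 fun t ht => (hneg t ⟨ht.1.le, ht.2.trans hξ.2⟩).le⟩

theorem IsIntegratedWave.integral_g_pos (h : IsIntegratedWave R f D g c univ φ Z)
    (A : IsAdmissible R f D g) {a b : ℝ} (hab : a < b) (hlt : ∀ ξ ∈ Icc a b, φ ξ < R) :
    0 < ∫ ξ in a..b, g (φ ξ) := by
  have hgφ : Continuous fun ξ => g (φ ξ) :=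
    continuousOn_univ.1 (A.g_cont.comp h.continuous h.mapsTo)
  exact intervalIntegral.intervalIntegral_pos_of_pos_on (hgφ.intervalIntegrable _ _)
    (fun x hx => A.g_pos _ ⟨(h.mapsTo trivial).1, hlt x (Ioo_subset_Icc_self hx)⟩) hab

/-- A wave on the whole line cannot decrease at a density below `R`. -/
theorem IsIntegratedWave.not_Z_neg (h : IsIntegratedWave R f D g c univ φ Z)
    (A : IsAdmissible R f D g) {ξ₀ : ℝ} (hZ : Z ξ₀ < 0) (hR : φ ξ₀ < R) : False := by
  have hφc : Continuous φ := continuousOn_univ.1 h.continuous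
  have hgφ : Continuous fun ξ => g (φ ξ) :=
    continuousOn_univ.1 (A.g_cont.comp h.continuous h.mapsTo)
  have h0 : 0 < φ ξ₀ := (h.mapsTo trivial).1.lt_of_ne' fun he =>
    hZ.ne (h.Z_eq_zero_of_eq_zero A trivial he)
  by_cases hex : ∃ ξ, ξ₀ ≤ ξ ∧ φ ξ = 0
  · -- the first zero
    set S := Ici ξ₀ ∩ φ ⁻¹' {0} with hS
    have hcl : IsClosed S := isClosed_Ici.inter (isClosed_singleton.preimage hφc)
    have hbd : BddBelow S := ⟨ξ₀, fun x hx => hx.1⟩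
    have hτ : sInf S ∈ S := hcl.csInf_mem hex hbd
    set τ := sInf S
    have hφτ : φ τ = 0 := hτ.2
    have hξτ : ξ₀ < τ := lt_of_le_of_ne hτ.1 fun he => by rw [← he] at hφτ; linarith
    have hpos : ∀ ξ ∈ Ico ξ₀ τ, 0 < φ ξ := fun ξ hξ =>
      (h.mapsTo trivial).1.lt_of_ne' fun he =>
        absurd (csInf_le hbd (⟨hξ.1, he⟩ : ξ ∈ S)) (not_le.2 hξ.2)
    have hneg := h.Z_neg_of_pos A hZ hR hpos
    have hZτ := h.Z_eq_zero_of_eq_zero A (ξ := τ) trivial hφτ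
    have hle : ∀ ξ ∈ Icc ξ₀ τ, φ ξ < R := by
      intro ξ hξ
      rcases hξ.2.eq_or_lt with rfl | hlt
      · rw [hφτ]; exact A.R_pos
      · exact (hneg ξ ⟨hξ.1, hlt⟩).2.trans_lt hR
    -- Each such density is attained before `τ`. The balance up to `τ`, where `Z` and `φ` vanish,
    -- gives `f s - c s = Z - ∫ g < 0`.
    have hqneg : ∀ s ∈ Ioc 0 (φ ξ₀), f s - c * s < 0 := by
      intro s hs
      obtain ⟨ξ, hξ, rfl⟩ := intermediate_value_Icc' hξτ.le hφc.continuousOn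
        (⟨hφτ ▸ hs.1.le, hs.2⟩ : s ∈ Icc (φ τ) (φ ξ₀))
      have hξlt : ξ < τ := hξ.2.lt_of_ne fun he => by rw [he, hφτ] at hs; exact lt_irrefl _ hs.1
      have e := h.balance ξ trivial τ trivial
      have hI := h.integral_g_pos A hξlt fun x hx => hle x ⟨hξ.1.trans hx.1, hx.2⟩
      have := (hneg ξ ⟨hξ.1, hξlt⟩).1
      rw [hZτ, hφτ, A.f_zero] at e
      linarith
    have hev : ∀ᶠ ξ in 𝓝 τ, φ ξ < φ ξ₀ := hφc.continuousAt.eventually (by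
      rw [hφτ]; exact gt_mem_nhds h0)
    obtain ⟨ε, hε, hball⟩ := Metric.eventually_nhds_iff.1 hev
    have hnear : ∀ ξ ∈ Icc τ (τ + ε / 2), φ ξ < φ ξ₀ := fun ξ hξ => hball (by
      rw [Real.dist_eq, abs_of_nonneg (by linarith [hξ.1])]; linarith [hξ.2])
    -- Past `τ` the same sign of `f s - c s` keeps `Z` negative, so `primD D ∘ φ` would fall below
    -- its value `0` at `τ`.
    have hZright : ∀ ξ ∈ Ioc τ (τ + ε / 2), Z ξ < 0 := by
      intro ξ hξ
      have e := h.balance τ trivial ξ trivial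
      have hI := h.integral_g_pos A hξ.1 fun x hx =>
        (hnear x ⟨hx.1, hx.2.trans hξ.2⟩).trans hR
      have hq0 : f (φ ξ) - c * φ ξ ≤ 0 := by
        rcases (h.mapsTo (mem_univ ξ)).1.eq_or_lt with he | hlt
        · rw [← he, A.f_zero]; simp
        · exact (hqneg _ ⟨hlt, (hnear ξ (Ioc_subset_Icc_self hξ)).le⟩).le
      rw [hZτ, hφτ, A.f_zero] at e
      linarith
    have hanti : StrictAntiOn (fun η => primD D (φ η)) (Icc τ (τ + ε / 2)) :=
      strictAntiOn_of_hasDerivWithinAt_neg (f' := Z) (convex_Icc _ _)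
        (fun x _ => (h.hasDerivAt x trivial).continuousAt.continuousWithinAt)
        (fun x _ => (h.hasDerivAt x trivial).hasDerivWithinAt)
        (fun x hx => by rw [interior_Icc] at hx; exact hZright x ⟨hx.1, hx.2.le⟩)
    have hlt := hanti (left_mem_Icc.2 (by linarith)) (right_mem_Icc.2 (by linarith))
      (by linarith : τ < τ + ε / 2)
    have h1 := A.primD_nonneg (h.mapsTo (mem_univ (τ + ε / 2)))
    simp only [hφτ, primD, intervalIntegral.integral_same] at hlt h1
    linarith
  · -- the density stays positive
    push Not at hex
    have hneg : ∀ ξ, ξ₀ ≤ ξ → Z ξ < 0 ∧ φ ξ ≤ φ ξ₀ := fun ξ hξ =>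
      h.Z_neg_of_pos A hZ hR (b := ξ + 1)
        (fun t ht => (h.mapsTo trivial).1.lt_of_ne' (hex t ht.1)) ξ ⟨hξ, by linarith⟩
    obtain ⟨x0, hx0, hmin⟩ := isCompact_Icc.exists_isMinOn (nonempty_Icc.2 h0.le)
      (A.g_cont.mono (Icc_subset_Icc_right hR.le))
    set m := g x0
    have hm : 0 < m := A.g_pos x0 ⟨hx0.1, hx0.2.trans_lt hR⟩
    obtain ⟨Q, hQ⟩ := isCompact_Icc.exists_bound_of_continuousOn
      (A.f_contDiff.continuousOn.sub (continuousOn_const.mul continuousOn_id) :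
        ContinuousOn (fun s => f s - c * s) (Icc 0 R))
    have hQ' : ∀ ξ, |f (φ ξ) - c * φ ξ| ≤ Q := fun ξ => hQ (φ ξ) (h.mapsTo trivial)
    have hQ0 : 0 ≤ Q := (abs_nonneg _).trans (hQ' ξ₀)
    have hZle : ∀ ξ, ξ₀ ≤ ξ → Z ξ ≤ 2 * Q - m * (ξ - ξ₀) := by
      intro ξ hξ
      have e := h.balance ξ₀ trivial ξ trivial
      have hI : m * (ξ - ξ₀) ≤ ∫ t in ξ₀..ξ, g (φ t) := by
        have := intervalIntegral.integral_mono_on (μ := volume) hξ intervalIntegrable_const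
          (hgφ.intervalIntegrable ξ₀ ξ) (f := fun _ => m)
          (fun t ht => hmin ⟨(h.mapsTo trivial).1, (hneg t ht.1).2⟩)
        rwa [intervalIntegral.integral_const, smul_eq_mul, mul_comm] at this
      have h1 := abs_le.1 (hQ' ξ)
      have h2 := abs_le.1 (hQ' ξ₀)
      linarith [h1.2, h2.1]
    -- From `a` on, the linear bound gives `Z ≤ -1`, so after a further length `L + 1` the primitive
    -- of `D` would be negative.
    set a := ξ₀ + (2 * Q + 1) / m with ha
    have haξ : ξ₀ ≤ a := by rw [ha]; linarith [div_pos (by linarith : 0 < 2 * Q + 1) hm]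
    set L := primD D (φ a)
    have hL : 0 ≤ L := A.primD_nonneg (h.mapsTo trivial)
    have hb := Convex.image_sub_le_mul_sub_of_deriv_le (convex_Icc a (a + (L + 1)))
      (f := fun η => primD D (φ η)) (C := -1)
      (fun x _ => (h.hasDerivAt x trivial).continuousAt.continuousWithinAt)
      (fun x _ => (h.hasDerivAt x trivial).differentiableAt.differentiableWithinAt)
      (fun x hx => by
        have hx' := interior_subset hx
        rw [(h.hasDerivAt x trivial).deriv]
        have h1 := hZle x (haξ.trans hx'.1)
        have h2 : m * (a - ξ₀) = 2 * Q + 1 := by rw [ha]; field_simp; ring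
        have h3 : m * (a - ξ₀) ≤ m * (x - ξ₀) :=
          mul_le_mul_of_nonneg_left (by linarith [hx'.1]) hm.le
        linarith) a (left_mem_Icc.2 (by linarith)) (a + (L + 1)) (right_mem_Icc.2 (by linarith))
      (by linarith)
    have := A.primD_nonneg (h.mapsTo (mem_univ (a + (L + 1))))
    linarith

end Wave

/-! ### Semi-wavefronts from `R`: monotonicity and strictness -/

section SemiWavefrontFrom

variable {R : ℝ} {f D g : ℝ → ℝ} {c : ℝ} {φ y : ℝ → ℝ} {w : ℝ}

/-- An increasing profile would lie above its limit `R` at `-∞`, hence be constant. -/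
theorem IsSemiWavefrontFrom.antitoneOn (h : IsSemiWavefrontFrom R f D g c R w φ) :
    AntitoneOn φ (Iio w) := by
  obtain ⟨hm | ha, ξ₁, h₁, ξ₂, h₂, hne⟩ := h.monotonic
  · have : ∀ ξ < w, φ ξ = R := by
      intro ξ hξ
      refine le_antisymm (h.wave.mapsTo hξ).2 (le_of_tendsto h.tendsto ?_)
      filter_upwards [Iic_mem_atBot ξ] with η hη
      exact hm (lt_of_le_of_lt hη hξ) hξ hη
    exact absurd ((this ξ₁ h₁).trans (this ξ₂ h₂).symm) hne
  · exact ha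

theorem IsSemiWavefrontFrom.exists_lt (h : IsSemiWavefrontFrom R f D g c R w φ) :
    ∃ ξ < w, φ ξ < R := by
  obtain ⟨_, ξ₁, h₁, ξ₂, h₂, hne⟩ := h.monotonic
  by_contra! hcon
  exact hne ((le_antisymm (h.wave.mapsTo h₁).2 (hcon ξ₁ h₁)).trans
    (le_antisymm (h.wave.mapsTo h₂).2 (hcon ξ₂ h₂)).symm)

theorem IsSemiWavefrontFrom.exists_integrated (h : IsSemiWavefrontFrom R f D g c R w φ)
    (A : IsAdmissible R f D g) (hy : IsPhase R f D g c y) :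
    IsIntegratedWave R f D g c (Iio w) φ (fun ξ => -y (φ ξ)) := by
  obtain ⟨Z, hZ⟩ := h.wave.exists_isIntegratedWave A nonempty_Iio
  have e := hZ.Z_eq_neg_phase A hy h.antitoneOn h.tendsto
  exact ⟨hZ.isOpen, hZ.ordConnected, hZ.mapsTo, hZ.continuous,
    fun ξ hξ => e ξ hξ ▸ hZ.hasDerivAt ξ hξ,
    fun a ha b hb => by rw [← e a ha, ← e b hb]; exact hZ.balance a ha b hb⟩

/-- An extension would inherit `Z = -y(φ) < 0` at a point of density below `R`, which `not_Z_neg`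
excludes on the whole line. -/
theorem IsSemiWavefrontFrom.isStrict (h : IsSemiWavefrontFrom R f D g c R w φ)
    (A : IsAdmissible R f D g) : IsStrict R f D g c (Iio w) φ := by
  refine ⟨fun he => absurd (he ▸ mem_univ w : w ∈ Iio w) (lt_irrefl w), ?_⟩
  rintro ⟨φ', hφ', heq⟩
  obtain ⟨y, hy⟩ := A.exists_isPhase c
  obtain ⟨Z, hZ⟩ := hφ'.exists_isIntegratedWave A univ_nonempty
  obtain ⟨ξ, hξ, hlt⟩ := h.exists_lt
  have hanti : AntitoneOn φ' (Iio w) := h.antitoneOn.congr heq.symm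
  have hlim : Tendsto φ' atBot (𝓝 R) := by
    refine h.tendsto.congr' ?_
    filter_upwards [Iio_mem_atBot w] with η hη using (heq hη).symm
  have hZ' := hZ.mono isOpen_Iio ordConnected_Iio (subset_univ (Iio w))
  have e := hZ'.Z_eq_neg_phase A hy hanti hlim ξ hξ
  have hltR : φ' ξ < R := (heq hξ).symm ▸ hlt
  have hpos := hy.pos (φ' ξ) ⟨hZ'.pos_of_antitoneOn A hanti ξ hξ, hltR⟩
  exact hZ.not_Z_neg A (by linarith) hltR

end SemiWavefrontFrom

/-! ### Construction of the profile from the phase function -/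

/-- The time that the profile with phase function `y` takes to get from density `R / 2` to
density `s`. -/
def travelTime (R : ℝ) (D y : ℝ → ℝ) (s : ℝ) : ℝ := ∫ t in s..(R / 2), D t / y t

/-- The generalized inverse of `travelTime`. -/
def profile (R : ℝ) (D y : ℝ → ℝ) (ξ : ℝ) : ℝ := sSup {s ∈ Ioo 0 R | ξ ≤ travelTime R D y s}

/-- The time at which the profile vanishes. -/
def endTime (R : ℝ) (D y : ℝ → ℝ) : ℝ := sSup (travelTime R D y '' Ioo 0 R)

theorem IsAdmissible.half_mem {R : ℝ} {f D g : ℝ → ℝ} (A : IsAdmissible R f D g) :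
    R / 2 ∈ Ioo 0 R := ⟨by linarith [A.R_pos], by linarith [A.R_pos]⟩

theorem bddAbove_superlevel_travelTime (R : ℝ) (D y : ℝ → ℝ) (ξ : ℝ) :
    BddAbove {s ∈ Ioo 0 R | ξ ≤ travelTime R D y s} :=
  ⟨R, fun _ hs => hs.1.2.le⟩

theorem IsAdmissible.profile_mem {R : ℝ} {f D g y : ℝ → ℝ} (A : IsAdmissible R f D g) (ξ : ℝ) :
    profile R D y ξ ∈ Icc 0 R :=
  ⟨Real.sSup_nonneg fun _ hs => hs.1.1.le, Real.sSup_le (fun _ hs => hs.1.2.le) A.R_pos.le⟩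

theorem le_profile {R : ℝ} {D y : ℝ → ℝ} {s ξ : ℝ} (hs : s ∈ Ioo 0 R)
    (h : ξ ≤ travelTime R D y s) : s ≤ profile R D y ξ :=
  le_csSup (bddAbove_superlevel_travelTime R D y ξ) ⟨hs, h⟩

theorem IsAdmissible.profile_antitone {R : ℝ} {f D g y : ℝ → ℝ} (A : IsAdmissible R f D g) :
    Antitone (profile R D y) := by
  intro a b hab
  -- Beyond all travel times the convention `sSup ∅ = 0` gives the profile its least value.
  rcases ({s ∈ Ioo 0 R | b ≤ travelTime R D y s}).eq_empty_or_nonempty with he | hne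
  · rw [profile, he, Real.sSup_empty]
    exact (A.profile_mem a).1
  · exact csSup_le_csSup (bddAbove_superlevel_travelTime R D y a) hne
      fun s hs => ⟨hs.1, hab.trans hs.2⟩

theorem IsAdmissible.profile_pos {R : ℝ} {f D g y : ℝ → ℝ} (A : IsAdmissible R f D g) {ξ : ℝ}
    (hξ : ξ < endTime R D y) : 0 < profile R D y ξ := by
  obtain ⟨_, ⟨s, hs, rfl⟩, h⟩ := exists_lt_of_lt_csSup
    ((nonempty_Ioo.2 A.R_pos).image (travelTime R D y)) hξ
  exact hs.1.trans_le (le_profile hs h.le)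

theorem IsAdmissible.profile_tendsto {R : ℝ} {f D g y : ℝ → ℝ} (A : IsAdmissible R f D g) :
    Tendsto (profile R D y) atBot (𝓝 R) := by
  refine tendsto_order.2 ⟨fun a ha => ?_, fun a ha => Eventually.of_forall fun ξ =>
    (A.profile_mem ξ).2.trans_lt ha⟩
  obtain ⟨s, hs, hsR⟩ := exists_between (max_lt ha A.R_pos)
  have hs' : s ∈ Ioo 0 R := ⟨(le_max_right _ _).trans_lt hs, hsR⟩
  filter_upwards [Iic_mem_atBot (travelTime R D y s)] with ξ hξ
  exact ((le_max_left _ _).trans_lt hs).trans_le (le_profile hs' hξ)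

namespace IsPhase

variable {R : ℝ} {f D g : ℝ → ℝ} {c : ℝ} {y : ℝ → ℝ} (hy : IsPhase R f D g c y)
  (A : IsAdmissible R f D g)
include hy A

theorem nonneg {s : ℝ} (hs : s ∈ Ioc 0 R) : 0 ≤ y s := by
  rcases hs.2.eq_or_lt with rfl | h
  · exact hy.terminal.ge
  · exact (hy.pos s ⟨hs.1, h⟩).le

theorem slowness_continuousOn : ContinuousOn (fun t => D t / y t) (Ioo 0 R) :=
  (A.D_cont.mono Ioo_subset_Icc_self).div (hy.continuous.mono Ioo_subset_Ioc_self)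
    fun s hs => (hy.pos s hs).ne'

theorem travelTime_hasDerivAt {s : ℝ} (hs : s ∈ Ioo 0 R) :
    HasDerivAt (travelTime R D y) (-(D s / y s)) s := by
  have hc := hy.slowness_continuousOn A
  exact intervalIntegral.integral_hasDerivAt_left
    ((hc.mono (ordConnected_Ioo.uIcc_subset hs (A.half_mem))).intervalIntegrable)
    (hc.stronglyMeasurableAtFilter isOpen_Ioo s hs)
    (hc.continuousAt (Ioo_mem_nhds hs.1 hs.2))

theorem travelTime_continuousOn : ContinuousOn (travelTime R D y) (Ioo 0 R) :=
  fun _ hs => (hy.travelTime_hasDerivAt A hs).continuousAt.continuousWithinAt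

theorem travelTime_strictAntiOn : StrictAntiOn (travelTime R D y) (Ioo 0 R) :=
  strictAntiOn_of_hasDerivWithinAt_neg (convex_Ioo 0 R) (hy.travelTime_continuousOn A)
    (fun _ hs => (hy.travelTime_hasDerivAt A (interior_subset hs)).hasDerivWithinAt)
    (fun s hs => neg_neg_of_pos
      (div_pos (A.D_pos s (interior_subset hs)) (hy.pos s (interior_subset hs))))

/-- On densities up to `R / 2` one has `g ≥ m > 0`, so `m D / y ≤ D g / y = c - h - y'`. The right
side has bounded integrals because `y` is bounded; hence the end time is finite. -/
theorem bddAbove_travelTime : BddAbove (travelTime R D y '' Ioo 0 R) := by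
  have hR2 := A.half_mem
  obtain ⟨M, hM⟩ := hy.bounded
  obtain ⟨C, hC⟩ := isCompact_Icc.exists_bound_of_continuousOn
    (continuousOn_const.sub A.advSpeed_cont : ContinuousOn (fun s => c - advSpeed R f s) (Icc 0 R))
  obtain ⟨x0, hx0, hmin⟩ := isCompact_Icc.exists_isMinOn (nonempty_Icc.2 hR2.1.le)
    (A.g_cont.mono (Icc_subset_Icc_right hR2.2.le))
  set m := g x0
  have hm : 0 < m := A.g_pos x0 ⟨hx0.1, hx0.2.trans_lt hR2.2⟩
  have hC0 : 0 ≤ C := (norm_nonneg _).trans (hC 0 A.zero_mem)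
  have hM0 : 0 ≤ M := (hy.nonneg A ⟨hR2.1, hR2.2.le⟩).trans (hM _ ⟨hR2.1, hR2.2.le⟩)
  have hT2 : travelTime R D y (R / 2) = 0 := by simp [travelTime]
  refine ⟨(M + C * R) / m, ?_⟩
  rintro _ ⟨s, hs, rfl⟩
  rcases le_total (R / 2) s with h | h
  · have := (hy.travelTime_strictAntiOn A).antitoneOn hR2 hs h
    rw [hT2] at this
    exact this.trans (div_nonneg (add_nonneg hM0 (mul_nonneg hC0 A.R_pos.le)) hm.le)
  · have hsub : Icc s (R / 2) ⊆ Ioo 0 R := fun t ht => ⟨hs.1.trans_le ht.1, ht.2.trans_lt hR2.2⟩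
    have hd : ∀ t ∈ Icc s (R / 2), HasDerivAt (fun t => m * travelTime R D y t - y t + C * t)
        (m * -(D t / y t) - (c - advSpeed R f t - D t * g t / y t) + C * 1) t := fun t ht =>
      (((hy.travelTime_hasDerivAt A (hsub ht)).const_mul m).sub
        (hy.hasDerivAt t (hsub ht))).add ((hasDerivAt_id t).const_mul C)
    have hmono := monotoneOn_of_hasDerivWithinAt_nonneg (convex_Icc s (R / 2))
      (fun t ht => (hd t ht).continuousAt.continuousWithinAt)
      (fun t ht => (hd t (interior_subset ht)).hasDerivWithinAt)
      (fun t ht => by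
        have ht' := interior_subset ht
        have h1 : m ≤ g t := hmin ⟨(hsub ht').1.le, ht'.2⟩
        have h2 : 0 ≤ D t / y t := (div_pos (A.D_pos t (hsub ht')) (hy.pos t (hsub ht'))).le
        have h3 : c - advSpeed R f t ≤ C := (abs_le.1 (hC t (Ioo_subset_Icc_self (hsub ht')))).2
        have h4 : D t * g t / y t = g t * (D t / y t) := by ring
        rw [h4]
        nlinarith [mul_le_mul_of_nonneg_right h1 h2])
    have := hmono (left_mem_Icc.2 h) (right_mem_Icc.2 h) h
    simp only [hT2] at this
    have h5 := hM s ⟨hs.1, hs.2.le⟩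
    have h6 := hy.nonneg A ⟨hR2.1, hR2.2.le⟩
    have h7 : C * (R / 2) ≤ C * R := mul_le_mul_of_nonneg_left hR2.2.le hC0
    have h8 : 0 ≤ C * s := mul_nonneg hC0 hs.1.le
    rw [le_div_iff₀ hm]
    linarith

theorem profile_travelTime {s : ℝ} (hs : s ∈ Ioo 0 R) :
    profile R D y (travelTime R D y s) = s := by
  refine IsGreatest.csSup_eq ⟨⟨hs, le_rfl⟩, fun t ht => ?_⟩
  exact ((hy.travelTime_strictAntiOn A).le_iff_ge hs ht.1).1 ht.2

/-- A monotone map with dense range is continuous. The range contains `(0, R)`, which is dense in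
`[0, R]`; the order dual turns antitone into monotone. -/
theorem profile_continuous : Continuous (profile R D y) := by
  let P : ℝ → (Icc (0 : ℝ) R)ᵒᵈ := fun ξ => OrderDual.toDual ⟨profile R D y ξ, A.profile_mem ξ⟩
  have hm : Monotone P := fun a b hab => A.profile_antitone hab
  have hd : DenseRange P := by
    have hdense : Dense {x : Icc (0 : ℝ) R | (x : ℝ) ∈ Ioo 0 R} := by
      intro x
      rw [closure_subtype]
      have : ((↑) : Icc (0 : ℝ) R → ℝ) '' {x : Icc (0 : ℝ) R | (x : ℝ) ∈ Ioo 0 R} = Ioo 0 R := by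
        ext t
        constructor
        · rintro ⟨u, hu, rfl⟩; exact hu
        · intro ht; exact ⟨⟨t, Ioo_subset_Icc_self ht⟩, ht, rfl⟩
      rw [this, closure_Ioo A.R_pos.ne]
      exact x.2
    refine Dense.mono ?_ (hdense : Dense (X := (Icc (0 : ℝ) R)ᵒᵈ) _)
    intro x hx
    exact ⟨travelTime R D y (OrderDual.ofDual x : Icc (0 : ℝ) R),
      Subtype.ext (hy.profile_travelTime A hx)⟩
  have hc : Continuous fun ξ => OrderDual.ofDual (P ξ) := hm.continuous_of_denseRange hd
  exact continuous_subtype_val.comp hc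

theorem travelTime_profile {ξ : ℝ} (h : profile R D y ξ ∈ Ioo 0 R) :
    travelTime R D y (profile R D y ξ) = ξ := by
  have h1 : ∃ s ∈ Ioo 0 R, ξ ≤ travelTime R D y s := by
    by_contra! hcon
    have he : {s ∈ Ioo 0 R | ξ ≤ travelTime R D y s} = ∅ :=
      eq_empty_of_forall_notMem fun s hs => absurd hs.2 (not_le.2 (hcon s hs.1))
    rw [profile, he, Real.sSup_empty] at h
    exact lt_irrefl _ h.1
  have h2 : ∃ s ∈ Ioo 0 R, travelTime R D y s ≤ ξ := by
    obtain ⟨s, hs1, hs2⟩ := exists_between h.2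
    refine ⟨s, ⟨h.1.trans hs1, hs2⟩, ?_⟩
    by_contra! hcon
    exact absurd (le_profile ⟨h.1.trans hs1, hs2⟩ hcon.le) (not_le.2 hs1)
  obtain ⟨s₁, hs₁, h1⟩ := h1
  obtain ⟨s₂, hs₂, h2⟩ := h2
  obtain ⟨s, hs, rfl⟩ := (isPreconnected_Ioo.image _ (hy.travelTime_continuousOn A)).ordConnected.out
    (mem_image_of_mem _ hs₂) (mem_image_of_mem _ hs₁) ⟨h2, h1⟩
  rw [hy.profile_travelTime A hs]

theorem profile_hasDerivAt {ξ : ℝ} (h : profile R D y ξ ∈ Ioo 0 R) :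
    HasDerivAt (profile R D y) (-(y (profile R D y ξ) / D (profile R D y ξ))) ξ := by
  have hne : -(D (profile R D y ξ) / y (profile R D y ξ)) ≠ 0 :=
    neg_ne_zero.2 (div_pos (A.D_pos _ h) (hy.pos _ h)).ne'
  have := HasDerivAt.of_local_left_inverse (hy.profile_continuous A).continuousAt
    (hy.travelTime_hasDerivAt A h) hne (by
      filter_upwards [(hy.profile_continuous A).continuousAt.preimage_mem_nhds
        (Ioo_mem_nhds h.1 h.2)] with η hη using hy.travelTime_profile A hη)
  rwa [inv_neg, inv_div] at this

theorem travelTime_lt_endTime {s : ℝ} (hs : s ∈ Ioo 0 R) :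
    travelTime R D y s < endTime R D y := by
  obtain ⟨t, ht0, hts⟩ := exists_between hs.1
  have ht : t ∈ Ioo 0 R := ⟨ht0, hts.trans hs.2⟩
  exact (hy.travelTime_strictAntiOn A ht hs hts).trans_le
    (le_csSup (hy.bddAbove_travelTime A) (mem_image_of_mem _ ht))

theorem exists_profile_lt : ∃ ξ < endTime R D y, profile R D y ξ < R :=
  ⟨travelTime R D y (R / 2), hy.travelTime_lt_endTime A (A.half_mem), by
    rw [hy.profile_travelTime A (A.half_mem)]; exact (A.half_mem).2⟩

/-- Away from at most one point, the profile is either locally equal to `R`, or strictly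
between `0` and `R`. -/
theorem exists_junction : ∃ a, (∀ ξ < endTime R D y, ξ ≠ a →
      profile R D y ξ ∈ Ioo 0 R ∨ ∀ᶠ η in 𝓝 ξ, profile R D y η = R) ∧
    (a < endTime R D y → profile R D y a = R ∧
      ∀ ξ ∈ Ioo a (endTime R D y), profile R D y ξ ∈ Ioo 0 R) ∧
    ((∃ ξ, profile R D y ξ = R) → a < endTime R D y) := by
  obtain ⟨ξ₁, hξ₁, hlt⟩ := hy.exists_profile_lt A
  have hle : ∀ ξ, profile R D y ξ ≤ R := fun ξ => (A.profile_mem ξ).2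
  by_cases hex : ∃ ξ, profile R D y ξ = R
  · set S := profile R D y ⁻¹' {R} with hS
    have hbd : BddAbove S := ⟨ξ₁, fun x hx => le_of_not_gt fun h => by
      have := A.profile_antitone (y := y) h.le
      rw [show profile R D y x = R from hx] at this
      exact absurd this (not_le.2 hlt)⟩
    have ha : sSup S ∈ S :=
      (isClosed_singleton.preimage (hy.profile_continuous A)).csSup_mem hex hbd
    set a := sSup S
    have hPa : profile R D y a = R := ha
    have haw : a < endTime R D y := by
      refine lt_of_not_ge fun h => ?_
      have := A.profile_antitone (y := y) (hξ₁.le.trans h)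
      linarith
    have hright : ∀ ξ ∈ Ioo a (endTime R D y), profile R D y ξ ∈ Ioo 0 R := fun ξ hξ =>
      ⟨A.profile_pos hξ.2, (hle ξ).lt_of_ne fun he =>
        absurd (le_csSup hbd (he : ξ ∈ S)) (not_le.2 hξ.1)⟩
    refine ⟨a, fun ξ hξ hne => ?_, fun _ => ⟨hPa, hright⟩, fun _ => haw⟩
    rcases lt_or_gt_of_ne hne with h | h
    · right
      filter_upwards [Iio_mem_nhds h] with η hη
      exact le_antisymm (hle η) (hPa.symm.trans_le (A.profile_antitone (le_of_lt hη)))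
    · exact Or.inl (hright ξ ⟨h, hξ⟩)
  -- If `R` is never attained, the end time serves as a dummy junction outside the domain.
  · refine ⟨endTime R D y, fun ξ hξ _ => Or.inl ⟨A.profile_pos hξ, (hle ξ).lt_of_ne fun he =>
      hex ⟨ξ, he⟩⟩, fun h => absurd h (lt_irrefl _), fun h => absurd h hex⟩

/-- At density `R` both sides vanish because `D R = 0` and `y R = 0`, so the formula survives even
where the profile has a corner. -/
theorem flux_profile {ξ : ℝ} (hξ : ξ < endTime R D y) :
    flux D (profile R D y) ξ = -y (profile R D y ξ) := by
  rcases (A.profile_mem ξ).2.eq_or_lt with he | hlt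
  · rw [flux, he, A.D_zero, hy.terminal]; simp
  · have hin : profile R D y ξ ∈ Ioo 0 R := ⟨A.profile_pos hξ, hlt⟩
    rw [flux, (hy.profile_hasDerivAt A hin).deriv]
    have := (A.D_pos _ hin).ne'
    field_simp

theorem phase_profile_continuousOn :
    ContinuousOn (fun ξ => y (profile R D y ξ)) (Iio (endTime R D y)) :=
  hy.continuous.comp (hy.profile_continuous A).continuousOn
    fun _ hξ => ⟨A.profile_pos hξ, (A.profile_mem _).2⟩

theorem phase_profile_hasDerivAt {ξ : ℝ} (h : profile R D y ξ ∈ Ioo 0 R) :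
    HasDerivAt (fun η => -y (profile R D y η)) ((advSpeed R f (profile R D y ξ) - c)
      * (-(y (profile R D y ξ) / D (profile R D y ξ))) - g (profile R D y ξ)) ξ := by
  refine ((hy.hasDerivAt _ h).comp ξ (hy.profile_hasDerivAt A h)).neg.congr_deriv ?_
  have := (A.D_pos _ h).ne'
  have := (hy.pos _ h).ne'
  field_simp
  ring

theorem profile_differentiableAt {a ξ : ℝ} (hξ : ξ < endTime R D y) (hne : ξ ≠ a)
    (ha : ∀ ξ < endTime R D y, ξ ≠ a →
      profile R D y ξ ∈ Ioo 0 R ∨ ∀ᶠ η in 𝓝 ξ, profile R D y η = R) :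
    DifferentiableAt ℝ (profile R D y) ξ := by
  rcases ha ξ hξ hne with h | h
  · exact (hy.profile_hasDerivAt A h).differentiableAt
  · exact ((hasDerivAt_const ξ R).congr_of_eventuallyEq h).differentiableAt

/-- The fundamental theorem of calculus tolerates the junction: `-y - (f - c ·)` along the profile
is continuous there and has derivative `-g` elsewhere. -/
theorem profile_balance {a b : ℝ} (ha : a < endTime R D y) (hb : b < endTime R D y) :
    -y (profile R D y b) - -y (profile R D y a) =
      (f (profile R D y b) - c * profile R D y b) - (f (profile R D y a) - c * profile R D y a)
        - ∫ ξ in a..b, g (profile R D y ξ) := by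
  obtain ⟨j, hj, -⟩ := hy.exists_junction A
  set P := profile R D y
  have hsub : uIcc a b ⊆ Iio (endTime R D y) := ordConnected_Iio.uIcc_subset ha hb
  have hgP : Continuous fun ξ => g (P ξ) :=
    A.g_cont.comp_continuous (hy.profile_continuous A) A.profile_mem
  have hfP : Continuous fun ξ => f (P ξ) :=
    A.f_contDiff.continuousOn.comp_continuous (hy.profile_continuous A) A.profile_mem
  have := integral_eq_of_hasDerivAt_off_countable
    (fun ξ => -y (P ξ) - (f (P ξ) - c * P ξ)) (fun ξ => -g (P ξ)) (a := a) (b := b)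
    (countable_singleton j)
    (((hy.phase_profile_continuousOn A).mono hsub).neg.sub
      (hfP.sub (continuous_const.mul (hy.profile_continuous A))).continuousOn)
    (fun ξ hξ => by
      have hξw : ξ < endTime R D y := hsub (Ioo_subset_Icc_self hξ.1)
      rcases hj ξ hξw hξ.2 with h | h
      · have hd := hy.profile_hasDerivAt A h
        refine ((hy.phase_profile_hasDerivAt A h).sub
          (((A.f_hasDerivAt h).comp ξ hd).sub (hd.const_mul c))).congr_deriv ?_
        ring
      · have hR : P ξ = R := h.self_of_nhds
        rw [hR, A.g_zero, neg_zero]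
        refine (hasDerivAt_const ξ (-y R - (f R - c * R))).congr_of_eventuallyEq ?_
        filter_upwards [h] with η hη
        rw [hη])
    (hgP.neg.intervalIntegrable _ _)
  rw [intervalIntegral.integral_neg] at this
  linarith

theorem isTravelingWave_profile :
    IsTravelingWave R f D g c (Iio (endTime R D y)) (profile R D y) := by
  obtain ⟨j, hj, -⟩ := hy.exists_junction A
  set w := endTime R D y with hw
  have hPc := hy.profile_continuous A
  have hZc : ContinuousOn (fun ξ => -y (profile R D y ξ)) (Iio w) :=
    (hy.phase_profile_continuousOn A).neg
  have hflux : EqOn (flux D (profile R D y)) (fun ξ => -y (profile R D y ξ)) (Iio w) :=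
    fun ξ hξ => hy.flux_profile A hξ
  have hfc : ContinuousOn (flux D (profile R D y)) (Iio w) := hZc.congr hflux
  have hgP : Continuous fun ξ => g (profile R D y ξ) :=
    A.g_cont.comp_continuous hPc A.profile_mem
  refine ⟨isOpen_Iio, ordConnected_Iio, fun ξ _ => A.profile_mem ξ, hPc.continuousOn, ?_,
    hfc.locallyIntegrableOn measurableSet_Iio, fun a ha b hb => ?_, fun ψ hψ hψc hψI => ?_⟩
  · rw [ae_restrict_iff' measurableSet_Iio]
    filter_upwards [compl_mem_ae_iff.2 (measure_singleton j)] with ξ hne hξ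
    exact hy.profile_differentiableAt A hξ hne hj
  · have hsub : uIcc a b ⊆ Iio w := ordConnected_Iio.uIcc_subset ha hb
    rw [← A.primD_sub (A.profile_mem a) (A.profile_mem b)]
    refine (integral_eq_of_hasDerivAt_off_countable (fun ξ => primD D (profile R D y ξ))
      (flux D (profile R D y)) (countable_singleton j)
      (A.primD_cont.comp_continuous hPc A.profile_mem).continuousOn (fun ξ hξ => ?_)
      (hfc.mono hsub).intervalIntegrable).symm
    rcases hj ξ (hsub (Ioo_subset_Icc_self hξ.1)) hξ.2 with h | h
    · rw [flux, (hy.profile_hasDerivAt A h).deriv]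
      exact (A.primD_hasStrictDerivAt h).hasDerivAt.comp ξ (hy.profile_hasDerivAt A h)
    · rw [flux, h.self_of_nhds, A.D_zero, zero_mul]
      refine (hasDerivAt_const ξ (primD D R)).congr_of_eventuallyEq ?_
      filter_upwards [h] with η hη
      rw [hη]
  -- By the balance this combination is a constant minus a primitive of the continuous `g(φ)`; it is
  -- differentiable even at a corner of the profile.
  · have hd : ∀ ξ ∈ Iio w, HasDerivAt (fun ξ => -y (profile R D y ξ) - f (profile R D y ξ)
        + c * profile R D y ξ) (-g (profile R D y ξ)) ξ := by
      intro ξ hξ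
      have hG : HasDerivAt (fun η => ∫ t in ξ..η, g (profile R D y t)) (g (profile R D y ξ)) ξ :=
        intervalIntegral.integral_hasDerivAt_right (by simp)
          hgP.aestronglyMeasurable.stronglyMeasurableAtFilter hgP.continuousAt
      refine (hG.neg.const_add (-y (profile R D y ξ) - f (profile R D y ξ)
        + c * profile R D y ξ)).congr_of_eventuallyEq ?_
      filter_upwards [Iio_mem_nhds hξ] with η hη
      have := hy.profile_balance A hξ hη
      simp only [Pi.neg_apply]
      linarith
    obtain ⟨-, -, e⟩ := integral_mul_deriv_add_deriv_mul_eq_zero isOpen_Iio hd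
      hgP.neg.continuousOn hψ hψc hψI
    rw [← e]
    refine setIntegral_congr_fun measurableSet_Iio fun ξ hξ => ?_
    simp only [hflux hξ]
    ring

theorem isSemiWavefrontFrom_profile :
    IsSemiWavefrontFrom R f D g c R (endTime R D y) (profile R D y) where
  wave := hy.isTravelingWave_profile A
  mem := A.R_mem
  zero := A.g_zero
  monotonic := by
    refine ⟨Or.inr (A.profile_antitone.antitoneOn _), ?_⟩
    obtain ⟨s, hs1, hs2⟩ := exists_between (A.half_mem).2
    have hs : s ∈ Ioo 0 R := ⟨(A.half_mem).1.trans hs1, hs2⟩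
    refine ⟨_, hy.travelTime_lt_endTime A hs, _, hy.travelTime_lt_endTime A (A.half_mem), ?_⟩
    rw [hy.profile_travelTime A hs, hy.profile_travelTime A (A.half_mem)]
    exact hs1.ne'
  tendsto := A.profile_tendsto

/-- The balance bounds increments of the flux by those of the profile and of `ξ`. The profile is
absolutely continuous, being monotone and everywhere differentiable on `J`. -/
theorem isClassicalOn_profile {J : Set ℝ} (hJ : IsOpen J) (hJw : J ⊆ Iio (endTime R D y))
    (hd : ∀ ξ ∈ J, DifferentiableAt ℝ (profile R D y) ξ) :
    IsClassicalOn R f D g c J (profile R D y) := by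
  refine ⟨hd, fun a b hab => ?_, ?_⟩
  · have hac := absolutelyContinuousOnInterval_of_antitoneOn
      (A.profile_antitone.antitoneOn (uIcc a b)) (fun x hx => hd x (hab hx))
    obtain ⟨K, hK⟩ := A.f_lipschitz
    obtain ⟨M, hM⟩ := isCompact_Icc.exists_bound_of_continuousOn A.g_cont
    refine absolutelyContinuousOnInterval_of_dist_le (K := K + |c|) (M := M) hac
      fun x hx z hz => ?_
    have hxw := hJw (hab hx)
    have hzw := hJw (hab hz)
    rw [hy.flux_profile A hxw, hy.flux_profile A hzw, Real.dist_eq, hy.profile_balance A hzw hxw]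
    have h1 := hK.dist_le_mul _ (A.profile_mem (y := y) x) _ (A.profile_mem (y := y) z)
    have h2 : ‖∫ ξ in z..x, g (profile R D y ξ)‖ ≤ M * |x - z| :=
      intervalIntegral.norm_integral_le_of_norm_le_const fun ξ _ => hM _ (A.profile_mem ξ)
    rw [Real.norm_eq_abs] at h2
    rw [Real.dist_eq] at h1
    rw [Real.dist_eq, Real.dist_eq]
    have e : f (profile R D y x) - c * profile R D y x - (f (profile R D y z)
        - c * profile R D y z) - ∫ ξ in z..x, g (profile R D y ξ)
        = (f (profile R D y x) - f (profile R D y z))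
          - c * (profile R D y x - profile R D y z) - ∫ ξ in z..x, g (profile R D y ξ) := by ring
    rw [e]
    refine (abs_sub _ _).trans (add_le_add ((abs_sub _ _).trans ?_) h2)
    rw [abs_mul, add_mul]
    exact add_le_add h1 le_rfl
  · obtain ⟨j, hj, -⟩ := hy.exists_junction A
    rw [ae_restrict_iff' hJ.measurableSet]
    filter_upwards [compl_mem_ae_iff.2 (measure_singleton j)] with ξ hne hξ
    have hξw := hJw hξ
    have hev : flux D (profile R D y) =ᶠ[𝓝 ξ] fun η => -y (profile R D y η) := by
      filter_upwards [Iio_mem_nhds hξw] with η hη using hy.flux_profile A hη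
    rw [hev.deriv_eq]
    rcases hj ξ hξw hne with h | h
    · rw [(hy.phase_profile_hasDerivAt A h).deriv, (hy.profile_hasDerivAt A h).deriv]
      ring
    · have h1 : (fun η => -y (profile R D y η)) =ᶠ[𝓝 ξ] fun _ => 0 := by
        filter_upwards [h] with η hη
        rw [hη, hy.terminal, neg_zero]
      have h2 : profile R D y =ᶠ[𝓝 ξ] fun _ => R := h
      rw [h1.deriv_eq, h2.deriv_eq, h.self_of_nhds, A.g_zero]
      simp

/-- A profile that is not differentiable at some point is sharp there. -/
theorem isSharpAt_profile {ξ : ℝ} (hξ : ξ < endTime R D y)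
    (hd : ¬ DifferentiableAt ℝ (profile R D y) ξ) :
    IsSharpAt R f D g c (Iio (endTime R D y)) (profile R D y) R := by
  obtain ⟨j, hj, hj2, -⟩ := hy.exists_junction A
  have hξj : ξ = j := by
    by_contra hne
    exact hd (hy.profile_differentiableAt A hξ hne hj)
  subst hξj
  exact ⟨A.g_zero, ξ, hξ, (hj2 hξ).1, hy.isClassicalOn_profile A
    (isOpen_Iio.sdiff isClosed_singleton) sdiff_subset
    (fun η hη => hy.profile_differentiableAt A hη.1 hη.2 hj), hd⟩

theorem profileFrom_profile : ProfileFrom R f D g c (endTime R D y) (profile R D y) := by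
  refine ⟨hy.isSemiWavefrontFrom_profile A, ?_⟩
  by_cases h : ∀ ξ < endTime R D y, DifferentiableAt ℝ (profile R D y) ξ
  · exact Or.inl (hy.isClassicalOn_profile A isOpen_Iio subset_rfl h)
  · push Not at h
    obtain ⟨ξ, hξ, hd⟩ := h
    exact Or.inr ⟨R, hy.isSharpAt_profile A hξ hd⟩

/-- Uniqueness up to shifts. -/
theorem eq_profile_shift {w : ℝ} {φ : ℝ → ℝ} (h : IsSemiWavefrontFrom R f D g c R w φ) :
    ∃ s : ℝ, w ≤ endTime R D y + s ∧ ∀ ξ < w, φ ξ = profile R D y (ξ - s) := by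
  have hI := h.exists_integrated A hy
  have hanti := h.antitoneOn
  have hpos := hI.pos_of_antitoneOn A hanti
  obtain ⟨ξ₁, hξ₁, hlt₁⟩ := h.exists_lt
  set S := {ξ | ξ < w ∧ φ ξ < R} with hS
  have hSo : IsOpen S := hI.continuous.isOpen_inter_preimage isOpen_Iio isOpen_Iio
  have hSc : S.OrdConnected := ⟨fun a ha b hb x hx =>
    ⟨hx.2.trans_lt hb.1, (hanti ha.1 (hx.2.trans_lt hb.1) hx.1).trans_lt ha.2⟩⟩
  have hin : ∀ ξ ∈ S, φ ξ ∈ Ioo 0 R := fun ξ hξ => ⟨hpos ξ hξ.1, hξ.2⟩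
  -- The factors `-D / y` of the travel time and `-y / D` of `φ` cancel.
  have hd : ∀ ξ ∈ S, HasDerivAt (fun η => travelTime R D y (φ η) - η) 0 ξ := by
    intro ξ hξ
    refine (((hy.travelTime_hasDerivAt A (hin ξ hξ)).comp ξ
      (hI.phi_hasDerivAt A hξ.1 (hin ξ hξ))).sub (hasDerivAt_id ξ)).congr_deriv ?_
    have := (A.D_pos _ (hin ξ hξ)).ne'
    have := (hy.pos _ (hin ξ hξ)).ne'
    field_simp
    ring
  have hconst : ∀ ξ ∈ S, travelTime R D y (φ ξ) - ξ = travelTime R D y (φ ξ₁) - ξ₁ :=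
    fun ξ hξ => hSo.is_const_of_deriv_eq_zero hSc.isPreconnected
      (fun x hx => (hd x hx).differentiableAt.differentiableWithinAt)
      (fun x hx => (hd x hx).deriv) hξ ⟨hξ₁, hlt₁⟩
  set s := ξ₁ - travelTime R D y (φ ξ₁) with hs
  have hT : ∀ ξ ∈ S, travelTime R D y (φ ξ) = ξ - s := fun ξ hξ => by
    rw [hs]; linarith [hconst ξ hξ]
  refine ⟨s, le_of_forall_lt fun ξ hξ => ?_, fun ξ hξ => ?_⟩
  · have hm : max ξ ξ₁ ∈ S := ⟨max_lt hξ hξ₁,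
      (hanti hξ₁ (max_lt hξ hξ₁) (le_max_right _ _)).trans_lt hlt₁⟩
    have h1 := hy.travelTime_lt_endTime A (hin _ hm)
    rw [hT _ hm] at h1
    linarith [le_max_left ξ ξ₁]
  · rcases (h.wave.mapsTo hξ).2.eq_or_lt with he | hlt
    -- Where `φ ξ = R`, densities `σ < R` close to `R` are attained by `φ` at later points, so the
    -- shifted profile at `ξ` is at least `σ`.
    · refine he.trans (le_antisymm ?_ (A.profile_mem _).2)
      refine le_of_forall_lt fun a ha => ?_
      obtain ⟨σ, hσ1, hσ2⟩ := exists_between (max_lt ha hlt₁)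
      have hξξ₁ : ξ ≤ ξ₁ := by
        refine le_of_not_gt fun hgt => ?_
        have := hanti hξ₁ hξ hgt.le
        linarith
      obtain ⟨η, hη, rfl⟩ := intermediate_value_Icc' hξξ₁
        (h.wave.continuous.mono fun x hx => hx.2.trans_lt hξ₁)
        (⟨((le_max_right _ _).trans_lt hσ1).le, hσ2.le.trans_eq he.symm⟩ :
          σ ∈ Icc (φ ξ₁) (φ ξ))
      have hηS : η ∈ S := ⟨hη.2.trans_lt hξ₁, hσ2⟩
      refine ((le_max_left _ _).trans_lt hσ1).trans_le (le_profile (hin η hηS) ?_)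
      rw [hT η hηS]
      linarith [hη.1]
    · rw [← hT ξ ⟨hξ, hlt⟩, hy.profile_travelTime A (hin ξ ⟨hξ, hlt⟩)]

end IsPhase

namespace IsPhase

variable {R : ℝ} {f D g : ℝ → ℝ} {c : ℝ} {y : ℝ → ℝ}

/-! ### Regularity of the profile where it reaches `R` -/

/-- Only the junction is in question. The profile is constant on its left, and on its right the
slope `-y / D` tends to `0` by `hsmall`. -/
theorem differentiableAt_profile (hy : IsPhase R f D g c y) (A : IsAdmissible R f D g)
    (hsmall : ∀ ε > 0, ∀ᶠ s in 𝓝[<] R, y s ≤ ε * D s) :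
    ∀ ξ < endTime R D y, DifferentiableAt ℝ (profile R D y) ξ := by
  intro ξ hξ
  obtain ⟨j, hj, hj2, -⟩ := hy.exists_junction A
  rcases ne_or_eq ξ j with hne | rfl
  · exact hy.profile_differentiableAt A hξ hne hj
  obtain ⟨hR, hright⟩ := hj2 hξ
  have hIoo : Ioo ξ (endTime R D y) ∈ 𝓝[>] ξ := Ioo_mem_nhdsGT hξ
  have hleft : HasDerivWithinAt (profile R D y) 0 (Iic ξ) ξ := by
    refine (hasDerivWithinAt_const ξ (Iic ξ) R).congr_of_mem (fun η hη => ?_) (mem_Iic.2 le_rfl)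
    exact le_antisymm (A.profile_mem η).2 (hR.symm.trans_le (A.profile_antitone hη))
  have hratio : Tendsto (fun s => -(y s / D s)) (𝓝[<] R) (𝓝 0) := by
    rw [← neg_zero]
    refine Tendsto.neg (tendsto_order.2 ⟨fun a ha => ?_, fun a ha => ?_⟩)
    · filter_upwards [Ioo_mem_nhdsLT A.R_pos] with s hs
      exact ha.trans (div_pos (hy.pos s hs) (A.D_pos s hs))
    · filter_upwards [Ioo_mem_nhdsLT A.R_pos, hsmall (a / 2) (half_pos ha)] with s hs h
      rw [div_lt_iff₀ (A.D_pos s hs)]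
      nlinarith [A.D_pos s hs]
  have hto : Tendsto (profile R D y) (𝓝[>] ξ) (𝓝[<] R) := by
    refine tendsto_nhdsWithin_iff.2 ⟨?_, ?_⟩
    · have := ((hy.profile_continuous A).tendsto ξ).mono_left (nhdsWithin_le_nhds (s := Ioi ξ))
      rwa [hR] at this
    · filter_upwards [hIoo] with η hη using (hright η hη).2
  have hr : HasDerivWithinAt (profile R D y) 0 (Ici ξ) ξ := by
    refine hasDerivWithinAt_Ici_of_tendsto_deriv (s := Ioo ξ (endTime R D y))
      (fun η hη => (hy.profile_hasDerivAt A (hright η hη)).differentiableAt.differentiableWithinAt)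
      (hy.profile_continuous A).continuousWithinAt hIoo ?_
    refine (hratio.comp hto).congr' ?_
    filter_upwards [hIoo] with η hη
    exact (hy.profile_hasDerivAt A (hright η hη)).deriv.symm
  have := hleft.union hr
  rw [Iic_union_Ici, hasDerivWithinAt_univ] at this
  exact this.differentiableAt

/-- Near `R` the slope `-y / D` is at most `-δ`, so `R` is attained at a finite point. That point is
a maximum, where a derivative would be `0`, yet the right difference quotients stay below `-δ`. -/
theorem exists_not_differentiableAt_profile (hy : IsPhase R f D g c y) (A : IsAdmissible R f D g)
    {δ : ℝ} (hδ : 0 < δ) (hlarge : ∀ᶠ s in 𝓝[<] R, δ * D s ≤ y s) :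
    ∃ ξ < endTime R D y, profile R D y ξ = R ∧ ¬ DifferentiableAt ℝ (profile R D y) ξ := by
  obtain ⟨r, hrR, hr⟩ := (mem_nhdsLT_iff_exists_Ioo_subset' A.R_pos).1
    (inter_mem hlarge (Ioo_mem_nhdsLT A.R_pos))
  have hlow : ∀ s ∈ Ioo r R, s ∈ Ioo 0 R ∧ δ * D s ≤ y s := fun s hs => ⟨(hr hs).2, (hr hs).1⟩
  obtain ⟨s₀, hs₀⟩ := exists_between (mem_Iio.1 hrR)
  have hs₀' := (hlow s₀ hs₀).1
  -- the travel time is bounded below, so that the profile reaches `R`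
  have hbd : ∀ s ∈ Ioo 0 R, travelTime R D y s₀ - R / δ ≤ travelTime R D y s := by
    intro s hs
    rcases le_total s s₀ with h | h
    · have := (hy.travelTime_strictAntiOn A).antitoneOn hs hs₀' h
      linarith [div_pos A.R_pos hδ]
    · have hsub : Icc s₀ s ⊆ Ioo r R := fun t ht => ⟨hs₀.1.trans_le ht.1, ht.2.trans_lt hs.2⟩
      have hb := Convex.mul_sub_le_image_sub_of_le_deriv (convex_Icc s₀ s)
        (f := travelTime R D y) (C := -(1 / δ))
        (fun t ht => (hy.travelTime_hasDerivAt A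
          (hlow t (hsub ht)).1).continuousAt.continuousWithinAt)
        (fun t ht => (hy.travelTime_hasDerivAt A
          (hlow t (hsub (interior_subset ht))).1).differentiableAt.differentiableWithinAt)
        (fun t ht => by
          obtain ⟨h1, h2⟩ := hlow t (hsub (interior_subset ht))
          rw [(hy.travelTime_hasDerivAt A h1).deriv, neg_le_neg_iff,
            div_le_div_iff₀ (hy.pos t h1) hδ]
          linarith)
        s₀ (left_mem_Icc.2 h) s (right_mem_Icc.2 h) h
      have e : R / δ = 1 / δ * R := by ring
      have : 1 / δ * (s - s₀) ≤ 1 / δ * R :=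
        mul_le_mul_of_nonneg_left (by linarith [hs.2, hs₀'.1]) (by positivity)
      linarith
  have hex : ∃ ξ, profile R D y ξ = R := by
    refine ⟨travelTime R D y s₀ - R / δ, le_antisymm (A.profile_mem _).2 ?_⟩
    refine le_of_forall_lt fun a ha => ?_
    obtain ⟨s, hs1, hs2⟩ := exists_between (max_lt ha A.R_pos)
    have hs : s ∈ Ioo 0 R := ⟨(le_max_right _ _).trans_lt hs1, hs2⟩
    exact ((le_max_left _ _).trans_lt hs1).trans_le (le_profile hs (hbd s hs))
  obtain ⟨j, hj, hj2, hj3⟩ := hy.exists_junction A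
  have hjw := hj3 hex
  obtain ⟨hR, hright⟩ := hj2 hjw
  refine ⟨j, hjw, hR, fun hd => ?_⟩
  have hmax : IsLocalMax (profile R D y) j :=
    Eventually.of_forall fun η => (A.profile_mem η).2.trans_eq hR.symm
  have hd0 : HasDerivAt (profile R D y) 0 j := hmax.deriv_eq_zero ▸ hd.hasDerivAt
  have hslope := (hasDerivAt_iff_tendsto_slope.1 hd0).mono_left
    (nhdsWithin_mono j (fun x hx => ne_of_gt hx : Ioi j ⊆ {j}ᶜ))
  have hnear : ∀ᶠ η in 𝓝[>] j, profile R D y η ∈ Ioo r R ∧ η ∈ Ioo j (endTime R D y) := by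
    have h1 : ∀ᶠ η in 𝓝[>] j, r < profile R D y η :=
      nhdsWithin_le_nhds ((hy.profile_continuous A).continuousAt.eventually
        (by rw [hR]; exact lt_mem_nhds hrR))
    filter_upwards [h1, Ioo_mem_nhdsGT hjw] with η h2 h3
    exact ⟨⟨h2, (hright η h3).2⟩, h3⟩
  have : (0 : ℝ) ≤ -δ := by
    refine le_of_tendsto hslope ?_
    filter_upwards [hnear] with η hη
    have hin : ∀ t ∈ Ioo j η, profile R D y t ∈ Ioo r R := fun t ht =>
      ⟨hη.1.1.trans_le (A.profile_antitone ht.2.le), (hright t ⟨ht.1, ht.2.trans hη.2.2⟩).2⟩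
    have hb := Convex.image_sub_le_mul_sub_of_deriv_le (convex_Icc j η)
      (f := profile R D y) (C := -δ) (hy.profile_continuous A).continuousOn
      (fun t ht => by
        rw [interior_Icc] at ht
        exact (hy.profile_hasDerivAt A
          (hlow _ (hin t ht)).1).differentiableAt.differentiableWithinAt)
      (fun t ht => by
        rw [interior_Icc] at ht
        obtain ⟨h1, h2⟩ := hlow _ (hin t ht)
        rw [(hy.profile_hasDerivAt A h1).deriv, neg_le_neg_iff, le_div_iff₀ (A.D_pos _ h1)]
        exact h2)
      j (left_mem_Icc.2 hη.2.1.le) η (right_mem_Icc.2 hη.2.1.le) hη.2.1.le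
    rw [slope_def_field, div_le_iff₀ (sub_pos.2 hη.2.1)]
    exact hb
  linarith

/-! ### Estimates of the phase function near `R` -/

/-- Upper bounds by comparison. -/
theorem eventually_le_of_comparison (hy : IsPhase R f D g c y) (A : IsAdmissible R f D g)
    {E E' : ℝ → ℝ} (hE : ContinuousOn E (Icc 0 R)) (hER : E R = 0)
    (hE' : ∀ᶠ s in 𝓝[<] R, HasDerivAt E (E' s) s)
    (hcomp : ∀ᶠ s in 𝓝[<] R, E s < y s → E' s ≤ c - advSpeed R f s - D s * g s / y s) :
    ∀ᶠ s in 𝓝[<] R, y s ≤ E s := by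
  obtain ⟨r, hrR, hr⟩ := (mem_nhdsLT_iff_exists_Ioo_subset' A.R_pos).1
    (inter_mem (inter_mem hE' hcomp) (Ioo_mem_nhdsLT A.R_pos))
  filter_upwards [Ioo_mem_nhdsLT hrR] with s hs
  have hs0 : 0 < s := (hr hs).2.1
  have hin : ∀ t ∈ Ioo s R, t ∈ Ioo r R := fun t ht => ⟨hs.1.trans ht.1, ht.2⟩
  refine sub_nonpos.1 (nonpos_of_deriv_nonneg_of_pos (G := fun t => y t - E t) (a := s) (b := R)
    ((hy.continuous.mono fun t ht => ⟨hs0.trans_le ht.1, ht.2⟩).sub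
      (hE.mono (Icc_subset_Icc_left hs0.le)))
    (fun t ht => (hy.hasDerivAt t (hr (hin t ht)).2).sub (hr (hin t ht)).1.1) ?_ ?_ s
    (left_mem_Icc.2 hs.2.le))
  · simp [hER, hy.terminal]
  · intro t ht hpos
    exact sub_nonneg.2 ((hr (hin t ht)).1.2 (sub_pos.1 hpos))

theorem tendsto_left {u : ℝ → ℝ} (A : IsAdmissible R f D g) (hu : ContinuousOn u (Icc 0 R)) :
    Tendsto u (𝓝[<] R) (𝓝 (u R)) := by
  have := (hu R A.R_mem).mono_left (nhdsWithin_mono R Ioo_subset_Icc_self)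
  rwa [nhdsWithin_Ioo_eq_nhdsLT A.R_pos] at this

/-- The barrier is `ε D`. Where `y` exceeds it, `D g / y ≤ g / ε → 0`, and the comparison of slopes
reduces at `R` to `hlt`. -/
theorem eventually_le_mul_of_condD (hy : IsPhase R f D g c y) (A : IsAdmissible R f D g)
    (hD : CondD R D)
    (hlt : ∀ ε > 0, ε * derivWithin D (Icc 0 R) R < c - advSpeed R f R) :
    ∀ ε > 0, ∀ᶠ s in 𝓝[<] R, y s ≤ ε * D s := by
  intro ε hε
  have hDd : ContinuousOn (derivWithin D (Icc 0 R)) (Icc 0 R) :=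
    hD.contDiff.continuousOn_derivWithin (uniqueDiffOn_Icc A.R_pos) le_rfl
  refine hy.eventually_le_of_comparison A (E := fun s => ε * D s)
    (E' := fun s => ε * derivWithin D (Icc 0 R) s) (A.D_cont.const_mul ε)
    (by simp [A.D_zero]) ?_ ?_
  · filter_upwards [Ioo_mem_nhdsLT A.R_pos] with s hs
    exact (((hD.contDiff.differentiableOn one_ne_zero s
      (Ioo_subset_Icc_self hs)).hasDerivWithinAt).hasDerivAt
        (Icc_mem_nhds hs.1 hs.2)).const_mul ε
  · have h1 := (tendsto_left A hDd).const_mul ε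
    have h2 := (tendsto_left A (A.advSpeed_cont)).const_sub c
    have h3 := (tendsto_left A A.g_cont).div_const ε
    rw [A.g_zero, zero_div] at h3
    have h4 := h2.sub h3
    rw [sub_zero] at h4
    filter_upwards [h1.eventually_lt h4 (hlt ε hε), Ioo_mem_nhdsLT A.R_pos] with s hs hsR hys
    have hDs := A.D_pos s hsR
    have : D s * g s / y s ≤ g s / ε := by
      rw [div_le_div_iff₀ (hy.pos s hsR) hε]
      nlinarith [A.g_nonneg s (Ioo_subset_Icc_self hsR)]
    linarith

/-- Near `R` one has `y' ≤ c - h < -e` for some `e > 0`, hence `y ≥ e (R - s)`, while `D` is at most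
a multiple of `R - s` by its Lipschitz bound. -/
theorem eventually_mul_le_of_condD (hy : IsPhase R f D g c y) (A : IsAdmissible R f D g)
    (hD : CondD R D) (hc : c < advSpeed R f R) :
    ∃ δ > 0, ∀ᶠ s in 𝓝[<] R, δ * D s ≤ y s := by
  obtain ⟨K, hK⟩ := hD.contDiff.exists_lipschitzOnWith one_ne_zero (convex_Icc _ _) isCompact_Icc
  obtain ⟨e, he0, he⟩ := exists_between (sub_pos.2 hc)
  have hev : ∀ᶠ s in 𝓝[<] R, e < advSpeed R f s - c :=
    ((tendsto_left A A.advSpeed_cont).sub_const c).eventually (lt_mem_nhds he)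
  obtain ⟨r, hrR, hr⟩ := (mem_nhdsLT_iff_exists_Ioo_subset' A.R_pos).1
    (inter_mem hev (Ioo_mem_nhdsLT A.R_pos))
  have hK0 : (0 : ℝ) < K + 1 := by positivity
  refine ⟨e / (K + 1), by positivity, ?_⟩
  filter_upwards [Ioo_mem_nhdsLT hrR] with s hs
  have hs0 := (hr hs).2
  have h1 : e * (R - s) - y s ≤ 0 := by
    refine nonpos_of_deriv_nonneg_of_pos (G := fun t => e * (R - t) - y t)
      (G' := fun t => e * -1 - (c - advSpeed R f t - D t * g t / y t)) (a := s) (b := R)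
      ((by fun_prop : Continuous fun t => e * (R - t)).continuousOn.sub
        (hy.continuous.mono fun t ht => ⟨hs0.1.trans_le ht.1, ht.2⟩))
      (fun t ht => (((hasDerivAt_id t).const_sub R).const_mul e).sub
        (hy.hasDerivAt t (hr ⟨hs.1.trans ht.1, ht.2⟩).2)) (by simp [hy.terminal])
      (fun t ht _ => ?_) s (left_mem_Icc.2 hs.2.le)
    obtain ⟨h2, h3⟩ := hr ⟨hs.1.trans ht.1, ht.2⟩
    have h4 : 0 ≤ D t * g t / y t := div_nonneg (mul_nonneg (A.D_pos t h3).le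
      (A.g_nonneg t (Ioo_subset_Icc_self h3))) (hy.pos t h3).le
    have h5 : e < advSpeed R f t - c := h2
    linarith
  have h2 := hK.dist_le_mul s (Ioo_subset_Icc_self hs0) R A.R_mem
  rw [Real.dist_eq, Real.dist_eq, A.D_zero, sub_zero, abs_of_pos (A.D_pos s hs0), abs_sub_comm,
    abs_of_pos (sub_pos.2 hs.2)] at h2
  rw [div_mul_eq_mul_div, div_le_iff₀ hK0]
  have h3 : 0 < R - s := sub_pos.2 hs.2
  have h4 : D s ≤ (K + 1) * (R - s) := by linarith
  calc e * D s ≤ e * ((K + 1) * (R - s)) := mul_le_mul_of_nonneg_left h4 he0.le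
    _ = (e * (R - s)) * (K + 1) := by ring
    _ ≤ y s * (K + 1) := mul_le_mul_of_nonneg_right (by linarith) hK0.le

/-- The limit of `D g / (s - R)` gives a linear bound `y ≤ M (R - s)`, and the infinite slope of `D`
at `R` beats every linear function. -/
theorem eventually_le_mul_of_condDTilde (hy : IsPhase R f D g c y) (A : IsAdmissible R f D g)
    (hD : CondDTilde R D g) : ∀ ε > 0, ∀ᶠ s in 𝓝[<] R, y s ≤ ε * D s := by
  obtain ⟨l, -, hl⟩ := hD.limit
  obtain ⟨C, hC⟩ := isCompact_Icc.exists_bound_of_continuousOn A.advSpeed_cont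
  have hC0 : 0 ≤ C := (norm_nonneg _).trans (hC R A.R_mem)
  -- The terms `|c|`, `C` and `|l| + 1` bound `c`, `h` and `D g / y`; the bound on the last one uses
  -- `M ≥ 1`, so that `y > M (R - s)` implies `y ≥ R - s`.
  set M := |c| + C + |l| + 2 with hM
  have hM1 : 1 ≤ M := by
    have := abs_nonneg c
    have := abs_nonneg l
    linarith
  have hlin : ∀ᶠ s in 𝓝[<] R, y s ≤ M * (R - s) := by
    refine hy.eventually_le_of_comparison A (E := fun s => M * (R - s)) (E' := fun _ => M * -1)
      (by fun_prop) (by simp)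
      (Eventually.of_forall fun s => ((hasDerivAt_id s).const_sub R).const_mul M) ?_
    have hl' : ∀ᶠ s in 𝓝[<] R, l - 1 < D s * g s / (s - R) :=
      hl.eventually (lt_mem_nhds (by linarith))
    filter_upwards [hl', Ioo_mem_nhdsLT A.R_pos] with s h1 hs hys
    have hRs : 0 < R - s := sub_pos.2 hs.2
    have h2 : D s * g s ≤ (|l| + 1) * (R - s) := by
      rw [lt_div_iff_of_neg (by linarith)] at h1
      nlinarith [neg_abs_le l]
    have h3 : D s * g s / y s ≤ |l| + 1 := by
      rw [div_le_iff₀ (hy.pos s hs)]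
      have h4 : R - s ≤ y s := by nlinarith
      exact h2.trans (mul_le_mul_of_nonneg_left h4 (by positivity))
    have h5 := (abs_le.1 (hC s (Ioo_subset_Icc_self hs))).2
    have h6 := neg_abs_le c
    linarith
  intro ε hε
  filter_upwards [hlin, hD.deriv_end.eventually (eventually_le_atBot (-(M / ε))),
    Ioo_mem_nhdsLT A.R_pos] with s h1 h2 hs
  have hRs : 0 < R - s := sub_pos.2 hs.2
  rw [A.D_zero, sub_zero, div_le_iff_of_neg (by linarith)] at h2
  have h3 : M / ε * (R - s) ≤ D s := by linarith
  calc y s ≤ M * (R - s) := h1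
    _ = ε * (M / ε * (R - s)) := by field_simp
    _ ≤ ε * D s := mul_le_mul_of_nonneg_left h3 hε.le

end IsPhase

theorem CondD.derivWithin_nonpos {R : ℝ} {D : ℝ → ℝ} (hR : 0 < R) (hD : CondD R D) :
    derivWithin D (Icc 0 R) R ≤ 0 := by
  have h1 := (hD.contDiff.differentiableOn one_ne_zero R (right_mem_Icc.2 hR.le)).hasDerivWithinAt
  have h2 : HasDerivWithinAt D (derivWithin D (Icc 0 R) R) (Ioo 0 R) R :=
    h1.mono Ioo_subset_Icc_self
  rw [hasDerivWithinAt_iff_tendsto_slope' (by simp), nhdsWithin_Ioo_eq_nhdsLT hR] at h2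
  refine le_of_tendsto h2 ?_
  filter_upwards [Ioo_mem_nhdsLT hR] with s hs
  rw [slope_def_field, hD.zero, sub_zero]
  exact div_nonpos_of_nonneg_of_nonpos (hD.pos s hs).le (by linarith [hs.2])

/-! ### Classification of profiles from `R` -/

section ProfileFrom

variable {R : ℝ} {f D g : ℝ → ℝ} {c w : ℝ} {φ y : ℝ → ℝ}

theorem IsSharpAt.eq_R {I : Set ℝ} {l : ℝ} (A : IsAdmissible R f D g) (hφ : MapsTo φ I (Icc 0 R))
    (h : IsSharpAt R f D g c I φ l) : l = R := by
  obtain ⟨hg, ξ, hξ, rfl, -⟩ := h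
  have hm := hφ hξ
  exact le_antisymm hm.2 (le_of_not_gt fun hlt => (A.g_pos _ ⟨hm.1, hlt⟩).ne' hg)

theorem ProfileFrom.isClassicalOn (h : ProfileFrom R f D g c w φ) (A : IsAdmissible R f D g)
    (hy : IsPhase R f D g c y)
    (hd : ∀ ξ < endTime R D y, DifferentiableAt ℝ (profile R D y) ξ) :
    IsClassicalOn R f D g c (Iio w) φ := by
  obtain ⟨h1, h2 | ⟨l, -, ξ, hξ, -, -, hnd⟩⟩ := h
  · exact h2
  · obtain ⟨s, hws, hs⟩ := hy.eq_profile_shift A h1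
    refine absurd ?_ hnd
    have hev : φ =ᶠ[𝓝 ξ] fun η => profile R D y (η - s) := by
      filter_upwards [Iio_mem_nhds hξ] with η hη using hs η hη
    refine DifferentiableAt.congr_of_eventuallyEq ?_ hev
    have hlt : ξ - s < endTime R D y := by
      have : ξ < w := hξ
      linarith
    exact DifferentiableAt.comp (g := profile R D y) (f := fun η => η - s) ξ (hd _ hlt)
      (differentiableAt_id.sub_const s)

theorem ProfileFrom.isSharpAt (h : ProfileFrom R f D g c w φ) (A : IsAdmissible R f D g)
    (hy : IsPhase R f D g c y)
    (hnd : ∃ ξ < endTime R D y, profile R D y ξ = R ∧ ¬ DifferentiableAt ℝ (profile R D y) ξ) :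
    IsSharpAt R f D g c (Iio w) φ R := by
  obtain ⟨h1, h2 | ⟨l, hl⟩⟩ := h
  · obtain ⟨s, hws, hs⟩ := hy.eq_profile_shift A h1
    obtain ⟨ξ, hξ, hR, hnd⟩ := hnd
    obtain ⟨ξ₁, hξ₁, hlt⟩ := h1.exists_lt
    refine absurd ?_ hnd
    -- Restriction to a half-line cannot cut off the corner: before it the canonical profile equals
    -- `R`, and `φ` takes a smaller value.
    have hξw : ξ + s < w := by
      refine lt_of_not_ge fun hge => ?_
      rw [hs ξ₁ hξ₁] at hlt
      have := A.profile_antitone (y := y) (by linarith : ξ₁ - s ≤ ξ)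
      linarith
    have hev : profile R D y =ᶠ[𝓝 ξ] fun η => φ (η + s) := by
      filter_upwards [Iio_mem_nhds (by linarith : ξ < w - s)] with η hη
      rw [hs (η + s) (by linarith [mem_Iio.1 hη]), add_sub_cancel_right]
    refine DifferentiableAt.congr_of_eventuallyEq ?_ hev
    exact (h2.differentiable _ hξw).comp ξ (differentiableAt_id.add_const s)
  · rwa [hl.eq_R A h1.wave.mapsTo] at hl

theorem exists_profileFrom (A : IsAdmissible R f D g) (c : ℝ) :
    ∃ (w : ℝ) (φ : ℝ → ℝ), ProfileFrom R f D g c w φ ∧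
      ∀ (w' : ℝ) (φ' : ℝ → ℝ), ProfileFrom R f D g c w' φ' →
        ∃ s : ℝ, w' ≤ w + s ∧ ∀ ξ < w', φ' ξ = φ (ξ - s) := by
  obtain ⟨y, hy⟩ := A.exists_isPhase c
  exact ⟨_, _, hy.profileFrom_profile A, fun w' φ' h => hy.eq_profile_shift A h.1⟩

theorem ProfileFrom.type (h : ProfileFrom R f D g c w φ) (A : IsAdmissible R f D g) :
    IsStrict R f D g c (Iio w) φ ∧
      (CondD R D →
        (c < advSpeed R f R → IsSharpAt R f D g c (Iio w) φ R) ∧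
        (advSpeed R f R < c → IsClassicalOn R f D g c (Iio w) φ) ∧
        (c = advSpeed R f R → derivWithin D (Icc 0 R) R < 0 →
          IsClassicalOn R f D g c (Iio w) φ)) ∧
      (CondDTilde R D g → IsClassicalOn R f D g c (Iio w) φ) := by
  obtain ⟨y, hy⟩ := A.exists_isPhase c
  refine ⟨h.1.isStrict A, fun hD => ⟨fun hc => ?_, fun hc => ?_, fun hc hd => ?_⟩, fun hD => ?_⟩
  · obtain ⟨δ, hδ, hlarge⟩ := hy.eventually_mul_le_of_condD A hD hc
    exact h.isSharpAt A hy (hy.exists_not_differentiableAt_profile A hδ hlarge)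
  · refine h.isClassicalOn A hy (hy.differentiableAt_profile A
      (hy.eventually_le_mul_of_condD A hD fun ε hε => ?_))
    have := mul_nonpos_of_nonneg_of_nonpos hε.le (hD.derivWithin_nonpos A.R_pos)
    linarith
  · refine h.isClassicalOn A hy (hy.differentiableAt_profile A
      (hy.eventually_le_mul_of_condD A hD fun ε hε => ?_))
    rw [hc, sub_self]
    exact mul_neg_of_pos_of_neg hε hd
  · exact h.isClassicalOn A hy (hy.differentiableAt_profile A
      (hy.eventually_le_mul_of_condDTilde A hD))

end ProfileFrom

/-! ### Reflection

Reversing the direction of space turns waves with flux `f` and speed `c` into waves with flux `-f`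
and speed `-c`. -/

section Reflection

variable {R : ℝ} {f D g : ℝ → ℝ} {c : ℝ} {φ : ℝ → ℝ}

theorem flux_comp_neg (D φ : ℝ → ℝ) (ξ : ℝ) :
    flux D (fun x => φ (-x)) ξ = -flux D φ (-ξ) := by
  simp only [flux, deriv_comp_neg]
  ring

theorem advSpeed_neg (R : ℝ) (f : ℝ → ℝ) (s : ℝ) :
    advSpeed R (fun x => -f x) s = -advSpeed R f s := derivWithin.fun_neg

theorem ae_restrict_comp_neg {I : Set ℝ} (hI : MeasurableSet I) {p : ℝ → Prop}
    (h : ∀ᵐ x ∂volume.restrict I, p x) : ∀ᵐ x ∂volume.restrict (Neg.neg ⁻¹' I), p (-x) := by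
  rw [ae_restrict_iff' hI] at h
  rw [ae_restrict_iff' (measurable_neg hI)]
  exact (Measure.measurePreserving_neg (volume : Measure ℝ)).quasiMeasurePreserving.ae h

theorem IsTravelingWave.comp_neg {I : Set ℝ} (h : IsTravelingWave R f D g c I φ) :
    IsTravelingWave R (fun s => -f s) D g (-c) (Neg.neg ⁻¹' I) (fun ξ => φ (-ξ)) := by
  have hmp := Measure.measurePreserving_neg (volume : Measure ℝ)
  have hme : MeasurableEmbedding (Neg.neg : ℝ → ℝ) := (MeasurableEquiv.neg ℝ).measurableEmbedding
  have hopen : IsOpen (Neg.neg ⁻¹' I) := h.isOpen.preimage continuous_neg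
  refine ⟨hopen, ⟨fun a ha b hb x hx => h.ordConnected.out hb ha
    ⟨neg_le_neg hx.2, neg_le_neg hx.1⟩⟩, fun ξ hξ => h.mapsTo hξ,
    h.continuous.comp continuous_neg.continuousOn fun ξ hξ => hξ, ?_, ?_, fun a ha b hb => ?_,
    fun ψ hψ hψc hψI => ?_⟩
  · filter_upwards [ae_restrict_comp_neg h.isOpen.measurableSet h.ae_differentiable] with ξ hξ
    exact DifferentiableAt.comp (g := φ) ξ hξ differentiableAt_id.neg
  · have hl := h.flux_locallyIntegrable
    rw [locallyIntegrableOn_iff h.isOpen.isLocallyClosed] at hl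
    rw [locallyIntegrableOn_iff hopen.isLocallyClosed]
    intro K hKI hK
    have h1 : IntegrableOn (flux D φ) (Neg.neg ⁻¹' K) :=
      hl _ (fun x hx => by simpa using hKI hx) ((Homeomorph.neg ℝ).isCompact_preimage.2 hK)
    have h2 := ((hmp.integrableOn_comp_preimage hme).2 h1).neg
    have e : (Neg.neg ⁻¹' (Neg.neg ⁻¹' K) : Set ℝ) = K := by ext; simp
    rw [e] at h2
    refine h2.congr_fun (fun ξ _ => ?_) hK.measurableSet
    rw [flux_comp_neg]; rfl
  · rw [h.flux_weak (-a) ha (-b) hb]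
    simp_rw [flux_comp_neg]
    rw [intervalIntegral.integral_neg, intervalIntegral.integral_comp_neg,
      intervalIntegral.integral_symm]
  · have hts : tsupport (fun x => ψ (-x)) ⊆ I := by
      have : tsupport (fun x => ψ (-x)) = Neg.neg ⁻¹' tsupport ψ :=
        tsupport_comp_eq_preimage ψ (Homeomorph.neg ℝ)
      rw [this]
      intro x hx
      simpa using hψI hx
    -- Under reflection the bracket `D(φ) φ' - f(φ) + c φ` and the derivative of the test function
    -- both change sign, so their product is preserved.
    have e := h.weak_eq (fun x => ψ (-x)) (hψ.comp contDiff_neg)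
      (hψc.comp_homeomorph (Homeomorph.neg ℝ)) hts
    rw [← hmp.setIntegral_preimage_emb hme] at e
    rw [← e]
    refine setIntegral_congr_fun hopen.measurableSet fun ξ _ => ?_
    simp only [flux_comp_neg, deriv_comp_neg, neg_neg]
    ring

theorem IsClassicalOn.comp_neg {J : Set ℝ} (hJ : IsOpen J) (h : IsClassicalOn R f D g c J φ) :
    IsClassicalOn R (fun s => -f s) D g (-c) (Neg.neg ⁻¹' J) (fun ξ => φ (-ξ)) := by
  have hflux : flux D (fun x => φ (-x)) = fun ξ => -flux D φ (-ξ) := funext (flux_comp_neg D φ)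
  refine ⟨fun ξ hξ => DifferentiableAt.comp (g := φ) ξ (h.differentiable (-ξ) hξ)
    differentiableAt_id.neg, fun a b hab => ?_, ?_⟩
  · rw [hflux]
    refine (absolutelyContinuousOnInterval_comp_neg (h.flux_ac (-a) (-b) fun x hx => ?_)).neg
    have hx' : -x ∈ uIcc a b := by
      rw [mem_uIcc] at hx ⊢
      rcases hx with hx | hx
      · right; constructor <;> linarith [hx.1, hx.2]
      · left; constructor <;> linarith [hx.1, hx.2]
    simpa using hab hx'
  · filter_upwards [ae_restrict_comp_neg hJ.measurableSet h.ae_eq] with ξ hξ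
    rw [hflux, deriv.fun_neg, deriv_comp_neg, deriv_comp_neg, advSpeed_neg]
    linarith

theorem IsSharpAt.comp_neg {I : Set ℝ} (hI : IsOpen I) {l : ℝ}
    (h : IsSharpAt R f D g c I φ l) :
    IsSharpAt R (fun s => -f s) D g (-c) (Neg.neg ⁻¹' I) (fun ξ => φ (-ξ)) l := by
  obtain ⟨hg, ξ, hξ, hφ, hcl, hnd⟩ := h
  refine ⟨hg, -ξ, by simpa using hξ, by simpa using hφ, ?_, fun hd => hnd ?_⟩
  · have e : (Neg.neg ⁻¹' I \ {-ξ} : Set ℝ) = Neg.neg ⁻¹' (I \ {ξ}) := by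
      ext x
      simp
    rw [e]
    exact hcl.comp_neg (hI.sdiff isClosed_singleton)
  · have := DifferentiableAt.comp (g := fun x => φ (-x)) (f := fun x => -x) ξ hd
      differentiableAt_id.neg
    have e : (fun x => φ (-x)) ∘ (fun x => -x) = φ := by ext; simp
    rwa [e] at this

theorem IsClassicalOrSharp.comp_neg {I : Set ℝ} (hI : IsOpen I)
    (h : IsClassicalOrSharp R f D g c I φ) :
    IsClassicalOrSharp R (fun s => -f s) D g (-c) (Neg.neg ⁻¹' I) (fun ξ => φ (-ξ)) :=
  h.imp (fun h => h.comp_neg hI) fun ⟨l, hl⟩ => ⟨l, hl.comp_neg hI⟩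

theorem IsStrict.comp_neg {I : Set ℝ} (h : IsStrict R f D g c I φ) :
    IsStrict R (fun s => -f s) D g (-c) (Neg.neg ⁻¹' I) (fun ξ => φ (-ξ)) := by
  refine ⟨fun he => h.1 (eq_univ_of_forall fun x => ?_), ?_⟩
  · have : -x ∈ (Neg.neg ⁻¹' I : Set ℝ) := he ▸ mem_univ _
    simpa using this
  · rintro ⟨φ', hφ', heq⟩
    refine h.2 ⟨fun ξ => φ' (-ξ), ?_, fun ξ hξ => ?_⟩
    · simpa using hφ'.comp_neg
    · have : -ξ ∈ (Neg.neg ⁻¹' I : Set ℝ) := by simpa using hξ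
      simpa using heq this

theorem IsMonotonicNonconst.comp_neg {I : Set ℝ} (h : IsMonotonicNonconst I φ) :
    IsMonotonicNonconst (Neg.neg ⁻¹' I) (fun ξ => φ (-ξ)) := by
  obtain ⟨h1, ξ₁, h₁, ξ₂, h₂, hne⟩ := h
  refine ⟨h1.symm.imp (fun h a ha b hb hab => h hb ha (neg_le_neg hab))
    (fun h a ha b hb hab => h hb ha (neg_le_neg hab)), -ξ₁, by simpa using h₁, -ξ₂,
    by simpa using h₂, by simpa using hne⟩

theorem neg_preimage_Iio (w : ℝ) : (Neg.neg ⁻¹' Iio w : Set ℝ) = Ioi (-w) := by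
  ext x
  simp

theorem neg_preimage_Ioi (w : ℝ) : (Neg.neg ⁻¹' Ioi w : Set ℝ) = Iio (-w) := by
  ext x
  simp

variable {l w : ℝ}

theorem IsSemiWavefrontFrom.comp_neg (h : IsSemiWavefrontFrom R f D g c l w φ) :
    IsSemiWavefrontTo R (fun s => -f s) D g (-c) l (-w) (fun ξ => φ (-ξ)) where
  wave := neg_preimage_Iio w ▸ h.wave.comp_neg
  mem := h.mem
  zero := h.zero
  monotonic := neg_preimage_Iio w ▸ h.monotonic.comp_neg
  tendsto := h.tendsto.comp tendsto_neg_atTop_atBot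

theorem IsSemiWavefrontTo.comp_neg (h : IsSemiWavefrontTo R f D g c l w φ) :
    IsSemiWavefrontFrom R (fun s => -f s) D g (-c) l (-w) (fun ξ => φ (-ξ)) where
  wave := neg_preimage_Ioi w ▸ h.wave.comp_neg
  mem := h.mem
  zero := h.zero
  monotonic := neg_preimage_Ioi w ▸ h.monotonic.comp_neg
  tendsto := h.tendsto.comp tendsto_neg_atBot_atTop

theorem ProfileFrom.comp_neg (h : ProfileFrom R f D g c w φ) :
    ProfileTo R (fun s => -f s) D g (-c) (-w) (fun ξ => φ (-ξ)) :=
  ⟨h.1.comp_neg, neg_preimage_Iio w ▸ h.2.comp_neg isOpen_Iio⟩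

theorem ProfileTo.comp_neg (h : ProfileTo R f D g c w φ) :
    ProfileFrom R (fun s => -f s) D g (-c) (-w) (fun ξ => φ (-ξ)) :=
  ⟨h.1.comp_neg, neg_preimage_Ioi w ▸ h.2.comp_neg isOpen_Ioi⟩

theorem IsAdmissible.neg (A : IsAdmissible R f D g) : IsAdmissible R (fun s => -f s) D g :=
  { A with
    f_contDiff := A.f_contDiff.neg
    f_zero := by simp [A.f_zero] }

end Reflection

/-! ### Profiles to `R`, by reflection -/

section ProfileTo

variable {R : ℝ} {f D g : ℝ → ℝ} {c w : ℝ} {φ : ℝ → ℝ}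

theorem exists_profileTo (A : IsAdmissible R f D g) (c : ℝ) :
    ∃ (w : ℝ) (φ : ℝ → ℝ), ProfileTo R f D g c w φ ∧
      ∀ (w' : ℝ) (φ' : ℝ → ℝ), ProfileTo R f D g c w' φ' →
        ∃ s : ℝ, w + s ≤ w' ∧ ∀ ξ > w', φ' ξ = φ (ξ - s) := by
  obtain ⟨w, φ, h, huniq⟩ := exists_profileFrom A.neg (-c)
  refine ⟨-w, fun ξ => φ (-ξ), by simpa using h.comp_neg, fun w' φ' h' => ?_⟩
  obtain ⟨s, hs, heq⟩ := huniq _ _ h'.comp_neg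
  refine ⟨-s, by linarith, fun ξ hξ => ?_⟩
  have := heq (-ξ) (by linarith)
  rw [neg_neg] at this
  rw [this]
  congr 1
  ring

/-- Reflection turns `c < h(R)` into `-c > -h(R)`, which interchanges the sharp and the classical
case. -/
theorem ProfileTo.type (h : ProfileTo R f D g c w φ) (A : IsAdmissible R f D g) :
    IsStrict R f D g c (Ioi w) φ ∧
      (CondD R D →
        (c < advSpeed R f R → IsClassicalOn R f D g c (Ioi w) φ) ∧
        (advSpeed R f R < c → IsSharpAt R f D g c (Ioi w) φ R) ∧
        (c = advSpeed R f R → derivWithin D (Icc 0 R) R < 0 →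
          IsClassicalOn R f D g c (Ioi w) φ)) ∧
      (CondDTilde R D g → IsClassicalOn R f D g c (Ioi w) φ) := by
  obtain ⟨h1, h2, h3⟩ := h.comp_neg.type A.neg
  rw [advSpeed_neg] at h2
  have hcl : IsClassicalOn R (fun s => -f s) D g (-c) (Iio (-w)) (fun ξ => φ (-ξ)) →
      IsClassicalOn R f D g c (Ioi w) φ := fun h => by
    simpa [neg_preimage_Iio] using h.comp_neg isOpen_Iio
  have hsh : IsSharpAt R (fun s => -f s) D g (-c) (Iio (-w)) (fun ξ => φ (-ξ)) R →
      IsSharpAt R f D g c (Ioi w) φ R := fun h => by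
    simpa [neg_preimage_Iio] using h.comp_neg isOpen_Iio
  refine ⟨by simpa [neg_preimage_Iio] using h1.comp_neg, fun hD => ⟨fun hc => ?_, fun hc => ?_,
    fun hc hd => ?_⟩, fun hD => hcl (h3 hD)⟩
  · exact hcl ((h2 hD).2.1 (neg_lt_neg hc))
  · exact hsh ((h2 hD).1 (neg_lt_neg hc))
  · exact hcl ((h2 hD).2.2 (by rw [hc]) hd)

end ProfileTo

/-! ### The borderline case -/

section Borderline

variable {R : ℝ}

theorem hasDerivAt_sub_pow (R : ℝ) (n : ℕ) (s : ℝ) :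
    HasDerivAt (fun t => (R - t) ^ n) (-(n * (R - s) ^ (n - 1))) s := by
  refine (((hasDerivAt_id s).const_sub R).pow n).congr_deriv ?_
  simp

theorem advSpeed_zero (R s : ℝ) : advSpeed R (fun _ => 0) s = 0 := by
  simp [advSpeed]

theorem condD_sub_sq (hR : 0 < R) :
    CondD R (fun s => (R - s) ^ 2) ∧ derivWithin (fun s => (R - s) ^ 2) (Icc 0 R) R = 0 := by
  refine ⟨⟨by fun_prop, by simp, fun s hs => by have := sub_pos.2 hs.2; positivity⟩, ?_⟩
  rw [(hasDerivAt_sub_pow R 2 R).hasDerivWithinAt.derivWithin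
    (uniqueDiffOn_Icc hR R (right_mem_Icc.2 hR.le))]
  simp

/-- Source terms for which, with `D s = (R - s) ^ 2` and `f = 0`, the phase function of speed
`0` is `(R - s) ^ (n + 2)`. -/
def borderlineSource (R : ℝ) (n : ℕ) (s : ℝ) : ℝ := (n + 2) * (R - s) ^ (2 * n + 1)

theorem standing_borderlineSource (R : ℝ) (n : ℕ) :
    Standing R (fun _ => 0) (borderlineSource R n) :=
  ⟨contDiffOn_const, rfl, by unfold borderlineSource; fun_prop⟩

theorem condG_borderlineSource (R : ℝ) (n : ℕ) : CondG R (borderlineSource R n) :=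
  ⟨fun s hs => by have := sub_pos.2 hs.2; unfold borderlineSource; positivity,
    by simp [borderlineSource]⟩

theorem isAdmissible_borderlineSource (hR : 0 < R) (n : ℕ) :
    IsAdmissible R (fun _ => 0) (fun s => (R - s) ^ 2) (borderlineSource R n) :=
  isAdmissible_of_cond hR (standing_borderlineSource R n) (condG_borderlineSource R n)
    (Or.inl (condD_sub_sq hR).1)

theorem isPhase_borderlineSource (R : ℝ) (n : ℕ) :
    IsPhase R (fun _ => 0) (fun s => (R - s) ^ 2) (borderlineSource R n) 0
      (fun s => (R - s) ^ (n + 2)) where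
  continuous := by fun_prop
  terminal := by simp
  pos := fun s hs => by have := sub_pos.2 hs.2; positivity
  hasDerivAt := fun s hs => by
    refine (hasDerivAt_sub_pow R (n + 2) s).congr_deriv ?_
    have := (sub_pos.2 hs.2).ne'
    rw [advSpeed_zero, borderlineSource]
    field_simp
    push_cast
    ring
  bounded := ⟨R ^ (n + 2), fun s hs =>
    pow_le_pow_left₀ (sub_nonneg.2 hs.2) (by linarith [hs.1]) _⟩

/-- For `n = 1` the quotient `y / D = R - s` tends to `0`. -/
theorem exists_borderline_classical (hR : 0 < R) :
    ∃ (w : ℝ) (φ : ℝ → ℝ),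
      IsSemiWavefrontFrom R (fun _ => 0) (fun s => (R - s) ^ 2) (borderlineSource R 1) 0 R w φ ∧
      IsClassicalOn R (fun _ => 0) (fun s => (R - s) ^ 2) (borderlineSource R 1) 0 (Iio w) φ := by
  have A := isAdmissible_borderlineSource hR 1
  have hy := isPhase_borderlineSource R 1
  refine ⟨_, _, hy.isSemiWavefrontFrom_profile A, hy.isClassicalOn_profile A isOpen_Iio subset_rfl
    (hy.differentiableAt_profile A fun ε hε => ?_)⟩
  filter_upwards [Ioo_mem_nhdsLT (by linarith : R - ε < R)] with s hs
  have h1 : R - s ≤ ε := by linarith [hs.1]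
  have := mul_le_mul_of_nonneg_right h1 (sq_nonneg (R - s))
  calc (R - s) ^ (1 + 2) = (R - s) * (R - s) ^ 2 := by ring
    _ ≤ ε * (R - s) ^ 2 := this

/-- For `n = 0` the phase function equals `D`, so the profile has slope `-1` below `R` and a corner
where it reaches `R`. -/
theorem exists_borderline_sharp (hR : 0 < R) :
    ∃ (w : ℝ) (φ : ℝ → ℝ),
      IsSemiWavefrontFrom R (fun _ => 0) (fun s => (R - s) ^ 2) (borderlineSource R 0) 0 R w φ ∧
      IsSharpAt R (fun _ => 0) (fun s => (R - s) ^ 2) (borderlineSource R 0) 0 (Iio w) φ R := by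
  have A := isAdmissible_borderlineSource hR 0
  have hy := isPhase_borderlineSource R 0
  obtain ⟨ξ, hξ, -, hd⟩ := hy.exists_not_differentiableAt_profile A one_pos
    (Eventually.of_forall fun s => by simp)
  exact ⟨_, _, hy.isSemiWavefrontFrom_profile A, hy.isSharpAt_profile A hξ hd⟩

end Borderline

end SemiWavefront

end

open SemiWavefront in
theorem mainTheorem1 (R : ℝ) (hR : 0 < R) :
    (∀ f D g : ℝ → ℝ, Standing R f g → CondG R g → (CondD R D ∨ CondDTilde R D g) → ∀ c : ℝ,
      -- existence and uniqueness up to shifts (a profile may be restricted to a smaller half-line)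
      (∃ (w : ℝ) (φ : ℝ → ℝ), ProfileFrom R f D g c w φ ∧
        ∀ (w' : ℝ) (φ' : ℝ → ℝ), ProfileFrom R f D g c w' φ' →
          ∃ s : ℝ, w' ≤ w + s ∧ ∀ ξ < w', φ' ξ = φ (ξ - s)) ∧
      (∃ (w : ℝ) (φ : ℝ → ℝ), ProfileTo R f D g c w φ ∧
        ∀ (w' : ℝ) (φ' : ℝ → ℝ), ProfileTo R f D g c w' φ' →
          ∃ s : ℝ, w + s ≤ w' ∧ ∀ ξ > w', φ' ξ = φ (ξ - s)) ∧
      -- properties of all profiles from `R`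
      (∀ (w : ℝ) (φ : ℝ → ℝ), ProfileFrom R f D g c w φ →
        IsStrict R f D g c (Iio w) φ ∧
        (CondD R D →
          (c < advSpeed R f R → IsSharpAt R f D g c (Iio w) φ R) ∧
          (advSpeed R f R < c → IsClassicalOn R f D g c (Iio w) φ) ∧
          (c = advSpeed R f R → derivWithin D (Icc 0 R) R < 0 →
            IsClassicalOn R f D g c (Iio w) φ)) ∧
        (CondDTilde R D g → IsClassicalOn R f D g c (Iio w) φ)) ∧
      -- properties of all profiles to `R`
      (∀ (w : ℝ) (φ : ℝ → ℝ), ProfileTo R f D g c w φ →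
        IsStrict R f D g c (Ioi w) φ ∧
        (CondD R D →
          (c < advSpeed R f R → IsClassicalOn R f D g c (Ioi w) φ) ∧
          (advSpeed R f R < c → IsSharpAt R f D g c (Ioi w) φ R) ∧
          (c = advSpeed R f R → derivWithin D (Icc 0 R) R < 0 →
            IsClassicalOn R f D g c (Ioi w) φ)) ∧
        (CondDTilde R D g → IsClassicalOn R f D g c (Ioi w) φ))) ∧
    -- in the borderline case with vanishing derivative of `D`, classical profiles do occur
    (∃ f D g : ℝ → ℝ, Standing R f g ∧ CondG R g ∧ CondD R D ∧
      derivWithin D (Icc 0 R) R = 0 ∧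
      (∃ (w : ℝ) (φ : ℝ → ℝ), IsSemiWavefrontFrom R f D g (advSpeed R f R) R w φ ∧
        IsClassicalOn R f D g (advSpeed R f R) (Iio w) φ) ∧
      (∃ (w : ℝ) (φ : ℝ → ℝ), IsSemiWavefrontTo R f D g (advSpeed R f R) R w φ ∧
        IsClassicalOn R f D g (advSpeed R f R) (Ioi w) φ)) ∧
    -- and so do sharp ones
    (∃ f D g : ℝ → ℝ, Standing R f g ∧ CondG R g ∧ CondD R D ∧
      derivWithin D (Icc 0 R) R = 0 ∧
      (∃ (w : ℝ) (φ : ℝ → ℝ), IsSemiWavefrontFrom R f D g (advSpeed R f R) R w φ ∧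
        IsSharpAt R f D g (advSpeed R f R) (Iio w) φ R) ∧
      (∃ (w : ℝ) (φ : ℝ → ℝ), IsSemiWavefrontTo R f D g (advSpeed R f R) R w φ ∧
        IsSharpAt R f D g (advSpeed R f R) (Ioi w) φ R)) := by
  refine ⟨fun f D g hs hg hD c => ?_, ?_, ?_⟩
  · have A := isAdmissible_of_cond hR hs hg hD
    exact ⟨exists_profileFrom A c, exists_profileTo A c, fun w φ h => h.type A,
      fun w φ h => h.type A⟩
  · obtain ⟨w, φ, h1, h2⟩ := exists_borderline_classical hR
    refine ⟨fun _ => 0, fun s => (R - s) ^ 2, borderlineSource R 1,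
      standing_borderlineSource R 1, condG_borderlineSource R 1, (condD_sub_sq hR).1,
      (condD_sub_sq hR).2, ?_, ?_⟩
    · rw [advSpeed_zero]
      exact ⟨w, φ, h1, h2⟩
    -- The data `f = 0`, `c = 0` are invariant under reflection, so the reflected profile solves the
    -- same equation.
    · rw [advSpeed_zero]
      exact ⟨-w, fun ξ => φ (-ξ), by simpa using h1.comp_neg,
        by simpa [neg_preimage_Iio] using h2.comp_neg isOpen_Iio⟩
  · obtain ⟨w, φ, h1, h2⟩ := exists_borderline_sharp hR
    refine ⟨fun _ => 0, fun s => (R - s) ^ 2, borderlineSource R 0,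
      standing_borderlineSource R 0, condG_borderlineSource R 0, (condD_sub_sq hR).1,
      (condD_sub_sq hR).2, ?_, ?_⟩
    · rw [advSpeed_zero]
      exact ⟨w, φ, h1, h2⟩
    · rw [advSpeed_zero]
      exact ⟨-w, fun ξ => φ (-ξ), by simpa using h1.comp_neg,
        by simpa [neg_preimage_Iio] using h2.comp_neg isOpen_Iio⟩
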